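/- **Definitions.** A small category $\mathcal I$ is an *indexing category* if every endomorphism in $\mathcal I$ is invertible, $\mathcal I$ has pullbacks, and each comma category $\mathcal I\downarrow a$ has a finite skeleton. Let $\mathcal U$ be a small category and let $\mathcal I,\mathcal A\subseteq\mathcal U$ be subcategories containing all objects such that every morphism of $\mathcal U$ is of the form $i\circ\alpha$ with $\alpha\in\mathcal A$, $i\in\mathcal I$ (written $\mathcal U=\mathcal I\circ\mathcal A$), where $\mathcal I$ is an indexing category and every isomorphism of $\mathcal I$ is an isomorphism of $\mathcal A$. This factorization *admits conjugation* if: * whenever $i\circ\alpha=j\circ\beta$ with $\alpha:a\to b$, $\beta:a\to c$ in $\mathcal A$ and $i:b\to d$, $j:c\to d$ in $\mathcal I$, there is an isomorphism $t:c\to b$ of $\mathcal I$ with $t\circ\beta=\alpha$ and $i\circ t=j$; * for all $\alpha:a\to b$ in $\mathcal A$ and $i:c\to b$ in $\mathcal I$ there is a pullback square $\alpha\circ i'=i\circ\alpha'$ in $\mathcal U$ with $i':p\to a$ in $\mathcal I$ and $\alpha':p\to c$ in $\mathcal A$, and the canonical isomorphism between any two such squares is an isomorphism of $\mathcal I$.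 In this case $\mathcal I\circ\mathcal A\circ\mathcal I^{\mathrm{op}}$ is the category with the objects of $\mathcal U$, whose morphisms $a\to b$ are the diagrams $a\xleftarrow{i}w\xrightarrow{\alpha}x\xrightarrow{j}b$ with $i,j\in\mathcal I$, $\alpha\in\mathcal A$, two such diagrams being identified if they are related by isomorphisms of $\mathcal I$ between the respective middle objects $w$ and $x$ that commute with all legs. The composite of $(i,\alpha,j):a\to b$ with $b\xleftarrow{k}y\xrightarrow{\gamma}z\xrightarrow{l}c$ is $(i k'',\ \gamma'\alpha',\ l j'')$, where $(k',j')$ is the pullback of $(j,k)$ in $\mathcal I$, $(k'',\alpha')$ is the pullback of $(\alpha,k')$ in $\mathcal U$ with $k''\in\mathcal I$, $\alpha'\in\mathcal A$, and $\gamma j'=j''\gamma'$ with $\gamma'\in\mathcal A$, $j''\in\mathcal I$. The category $\mathcal U$ embeds in it by $j\circ\alpha\mapsto(1,\alpha,j)$. A pair $(\mathcal B,\mathcal A)$ of small categories is a *conjugate pair* if there is a factorization $\mathcal U=\mathcal I\circ\mathcal A$ admitting conjugation with $\mathcal B$ equivalent to $\mathcal I\circ\mathcal A\circ\mathcal I^{\mathrm{op}}$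 (one may also replace $\mathcal A$ by an equivalent category). For a conjugate pair, identify $\mathcal B$ with $\mathcal I\circ\mathcal A\circ\mathcal I^{\mathrm{op}}$. A morphism of $\mathcal B$ is *regular* if it lies in $\mathcal U$ and *singular* otherwise. Let $\mathcal U(a,b)_+=\mathcal B(a,b)/\{\text{singular maps}\}$, i.e. the set of regular maps together with a disjoint base point, which represents the singular maps. Composition in $\mathcal B$ makes this a functor $\mathcal U_+:\mathcal A^{\mathrm{op}}\times\mathcal B\to\mathrm{Sets}_*$, the *regular bimodule*. Let $\mathcal C$ be a complete and cocomplete abelian category. For $X\in\mathcal C$ and a based set $S$, let $X\otimes S$ and $X^S$ denote the coproduct and the product of copies of $X$ indexed by the elements of $S$ other than the base point. The regular bimodule induces an adjunction $\mathcal L\dashv\mathcal R$, with $\mathcal L:[\mathcal B^{\mathrm{op}},\mathcal C]\to[\mathcal A^{\mathrm{op}},\mathcal C]$ and $\mathcal R:[\mathcal A^{\mathrm{op}},\mathcal C]\to[\mathcal B^{\mathrm{op}},\mathcal C]$ given by $$\mathcal L F(a)=\int^{b\in\mathcal B}F(b)\otimes\mathcal U(a,b)_+,\qquad \mathcal R G(b)=\int_{a\in\mathcal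 A}G(a)^{\mathcal U(a,b)_+},$$ whose adjunction bijection is the evident one: natural transformations $\mathcal LF\to G$ and $F\to\mathcal RG$ both amount to compatible families of morphisms $F(b)\to G(a)$ indexed by the elements of $\mathcal U(a,b)_+$ (the zero morphism for the base point). **Theorem.** Let $\mathcal C$ be a complete and cocomplete abelian category. 1. For every conjugate pair $(\mathcal B,\mathcal A)$ of small categories, the adjunction $(\mathcal L,\mathcal R)$ associated to the regular bimodule is an equivalence of categories $[\mathcal B^{\mathrm{op}},\mathcal C]\simeq[\mathcal A^{\mathrm{op}},\mathcal C]$: both functors are equivalences, and the unit and the counit are isomorphisms. 2. Let $\Gamma$ be the category of the based sets $\mathbf n_+=\{0,1,\dots,n\}$ ($n\ge 0$, base point $0$) and based maps, and let $\mathcal E$ be the category of the sets $\mathbf n=\{1,\dots,n\}$ ($n\ge0$) and surjections. Let $\mathcal U\subseteq\Gamma$ be the subcategory of the maps $\gamma$ with $\gamma^{-1}(0)=\{0\}$, let $\mathcal O\subseteq\mathcal U$ be the subcategory of the strictly increasing maps, and regard $\mathcal E$, by adding disjoint base points, as the subcategory of the surjections in $\mathcal U$. Then $\mathcal U=\mathcal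 O\circ\mathcal E$ admits conjugation and $\mathcal O\circ\mathcal E\circ\mathcal O^{\mathrm{op}}$ is equivalent to $\Gamma$, by an equivalence that is compatible, up to natural isomorphism, with the inclusions of $\mathcal U$. Hence $(\Gamma,\mathcal E)$ is a conjugate pair, and the adjunction $(\mathcal L,\mathcal R)$ of its regular bimodule is an equivalence of categories $[\Gamma^{\mathrm{op}},\mathcal C]\simeq[\mathcal E^{\mathrm{op}},\mathcal C]$ (Pirashvili's theorem). -/

import Mathlib

open CategoryTheory CategoryTheory.Limits Opposite

universe w v u v₁ u₁

noncomputable section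

namespace Conj

/-! ### Indexing categories and factorizations admitting conjugation -/

/-- A small category is an indexing category if it is an EI-category (every endomorphism is
invertible), has pullbacks, and every slice category `J ↓ a` has a finite skeleton. -/
structure IsIndexing (J : Type w) [SmallCategory J] : Prop where
  ei : ∀ {x : J} (f : x ⟶ x), IsIso f
  hasPullbacks : HasPullbacks J
  finite_skeleton : ∀ a : J, Finite (Skeleton (Over a))

section

variable {U : Type w} [SmallCategory U]

/-- `f` is an isomorphism of the subcategory `W`: both `f` and an inverse of `f` lie in `W`. -/
def IsoIn (W : MorphismProperty U) {x y : U} (f : x ⟶ y) : Prop :=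
  W f ∧ ∃ g : y ⟶ x, W g ∧ f ≫ g = 𝟙 x ∧ g ≫ f = 𝟙 y

/-- Let `I` and `A` be two subcategories of `U` containing all objects. The category `U` factors
as `I ∘ A`, where `I` is an indexing category with `Iso(I) ⊆ Iso(A)`, and this factorization
admits conjugation. -/
structure AdmitsConjugation (I A : MorphismProperty U) [I.IsMultiplicative]
    [A.IsMultiplicative] : Prop where
  /-- `I` is an indexing category. -/
  indexing : IsIndexing (WideSubcategory I)
  /-- every morphism of `U` is a morphism of `A` followed by a morphism of `I` -/
  factors : ∀ {x y : U} (f : x ⟶ y), ∃ (z : U) (α : x ⟶ z) (i : z ⟶ y), A α ∧ I i ∧ α ≫ i = f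
  /-- `Iso(I) ⊆ Iso(A)` -/
  iso_le : ∀ {x y : U} (f : x ⟶ y), IsoIn I f → IsoIn A f
  /-- the factorization is unique up to lifting isomorphisms in `I` -/
  lifts : ∀ {a b c d : U} (α : a ⟶ b) (i : b ⟶ d) (β : a ⟶ c) (j : c ⟶ d),
    A α → A β → I i → I j → α ≫ i = β ≫ j →
      ∃ t : c ⟶ b, β ≫ t = α ∧ t ≫ i = j ∧ IsoIn I t
  /-- morphisms of `A` can be pulled back along morphisms of `I` -/
  pullbacks : ∀ {a b c : U} (α : a ⟶ b) (i : c ⟶ b), A α → I i →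
    ∃ (p : U) (i' : p ⟶ a) (α' : p ⟶ c), I i' ∧ A α' ∧ IsPullback i' α' α i
  /-- the comparison isomorphism between two such pullbacks lies in `I` -/
  pullbacks_unique : ∀ {a b c : U} (α : a ⟶ b) (i : c ⟶ b), A α → I i →
    ∀ {p : U} (i' : p ⟶ a) (α' : p ⟶ c) {q : U} (i'' : q ⟶ a) (α'' : q ⟶ c),
      I i' → A α' → IsPullback i' α' α i → I i'' → A α'' → IsPullback i'' α'' α i →
        ∀ t : p ⟶ q, t ≫ i'' = i' → t ≫ α'' = α' → IsoIn I t

/-- A morphism of `U` lying in `W`, regarded as a morphism of the subcategory `W`. -/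
def wideHom {W : MorphismProperty U} [W.IsMultiplicative] {x y : U} (f : x ⟶ y) (hf : W f) :
    (⟨x⟩ : WideSubcategory W) ⟶ ⟨y⟩ := ⟨f, hf⟩

/-! ### Three-fold diagrams -/

/-- A diagram `a ← dom → cod → b` with legs `i` in `I`, `α` in `A` and `j` in `I`; it
represents the formal composite `j ∘ α ∘ i^*`. -/
structure Rep (I A : MorphismProperty U) (a b : U) where
  dom : U
  cod : U
  i : dom ⟶ a
  α : dom ⟶ cod
  j : cod ⟶ b
  hi : I i
  hα : A α
  hj : I j

variable {I A : MorphismProperty U}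

/-- Two diagrams are equivalent if there are isomorphisms of `I` between their middle objects
making everything commute. -/
def Rep.Equiv {a b : U} (x y : Rep I A a b) : Prop :=
  ∃ (φ : x.dom ⟶ y.dom) (ψ : x.cod ⟶ y.cod), IsoIn I φ ∧ IsoIn I ψ ∧
    φ ≫ y.i = x.i ∧ φ ≫ y.α = x.α ≫ ψ ∧ ψ ≫ y.j = x.j

/-- The composite of the last two legs of a three-fold diagram. -/
def Rep.u {a b : U} (x : Rep I A a b) : x.dom ⟶ b := x.α ≫ x.j

namespace AdmitsConjugation

variable [I.IsMultiplicative] [A.IsMultiplicative]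

theorem mono_wide (h : AdmitsConjugation I A)
    {x y : WideSubcategory I} (f : x ⟶ y) : Mono f := by
  have := h.indexing.hasPullbacks
  obtain ⟨d, h1, h2⟩ : ∃ d : x ⟶ pullback f f,
      d ≫ pullback.fst f f = 𝟙 x ∧ d ≫ pullback.snd f f = 𝟙 x :=
    ⟨pullback.lift (𝟙 x) (𝟙 x) rfl, pullback.lift_fst _ _ _, pullback.lift_snd _ _ _⟩
  have := h.indexing.ei (pullback.fst f f ≫ d)
  have : Epi d := by
    constructor
    intro z g k hgk
    have : (pullback.fst f f ≫ d) ≫ g = (pullback.fst f f ≫ d) ≫ k := by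
      simp only [Category.assoc, hgk]
    exact (cancel_epi (pullback.fst f f ≫ d)).1 this
  have e : pullback.fst f f = pullback.snd f f := by
    rw [← cancel_epi d, h1, h2]
  constructor
  intro z g k hgk
  have a1 : pullback.lift g k hgk ≫ pullback.fst f f = g := pullback.lift_fst _ _ _
  have a2 : pullback.lift g k hgk ≫ pullback.snd f f = k := pullback.lift_snd _ _ _
  exact a1.symm.trans (Eq.trans (by rw [e]) a2)

theorem cancel_I (h : AdmitsConjugation I A)
    {x y z : U} {f : x ⟶ z} {g k : y ⟶ x} (hf : I f) (hg : I g) (hk : I k)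
    (e : g ≫ f = k ≫ f) : g = k := by
  have := h.mono_wide (wideHom f hf)
  have : wideHom g hg = wideHom k hk := by
    rw [← cancel_mono (wideHom f hf)]
    exact WideSubcategory.hom_ext I e
  exact congrArg InducedWideCategory.Hom.hom this

theorem mono_of_I (h : AdmitsConjugation I A)
    {x y : U} {f : x ⟶ y} (hf : I f) : Mono f := by
  constructor
  intro z g k e
  obtain ⟨m, α, i, hα, hi, rfl⟩ := h.factors g
  obtain ⟨n, β, j, hβ, hj, rfl⟩ := h.factors k
  obtain ⟨t, h1, h2, h3⟩ := h.lifts α (i ≫ f) β (j ≫ f) hα hβ (I.comp_mem _ _ hi hf)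
    (I.comp_mem _ _ hj hf) (by simpa using e)
  have : t ≫ i = j := h.cancel_I hf (I.comp_mem _ _ h3.1 hi) hj (by simpa using h2)
  rw [← this, ← h1, Category.assoc]

theorem of_comp_I (h : AdmitsConjugation I A)
    {x y z : U} {t : x ⟶ y} {i : y ⟶ z} (hi : I i) (hti : I (t ≫ i)) : I t := by
  obtain ⟨m, α, j, hα, hj, rfl⟩ := h.factors t
  obtain ⟨s, h1, -, h3⟩ := h.lifts α (j ≫ i) (𝟙 x) ((α ≫ j) ≫ i) hα (A.id_mem _)
    (I.comp_mem _ _ hj hi) hti (by simp)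
  rw [Category.id_comp] at h1
  subst h1
  exact I.comp_mem _ _ h3.1 hj

theorem exists_pullback_I (h : AdmitsConjugation I A)
    {x y z : U} (f : x ⟶ z) (g : y ⟶ z) (hf : I f) (hg : I g) :
    ∃ (p : U) (g' : p ⟶ x) (f' : p ⟶ y) (hg' : I g') (hf' : I f'),
      IsPullback (wideHom g' hg') (wideHom f' hf') (wideHom f hf) (wideHom g hg) := by
  have := h.indexing.hasPullbacks
  exact ⟨_, _, _, (pullback.fst (wideHom f hf) (wideHom g hg)).2,
    (pullback.snd (wideHom f hf) (wideHom g hg)).2, IsPullback.of_hasPullback _ _⟩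

/-- Pullback squares of `I` are pullback squares of `U`. -/
theorem isPullback_of_wide (h : AdmitsConjugation I A)
    {p x y z : U} {g' : p ⟶ x} {f' : p ⟶ y} {f : x ⟶ z} {g : y ⟶ z}
    {hg' : I g'} {hf' : I f'} {hf : I f} {hg : I g}
    (sq : IsPullback (wideHom g' hg') (wideHom f' hf') (wideHom f hf) (wideHom g hg)) :
    IsPullback g' f' f g := by
  have w : g' ≫ f = f' ≫ g := congrArg InducedWideCategory.Hom.hom sq.w
  have := h.mono_of_I hg'
  refine IsPullback.mk' w (fun _ _ _ e _ ↦ by rwa [cancel_mono] at e) ?_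
  intro T a b e
  obtain ⟨m, α, i, hα, hi, rfl⟩ := h.factors a
  obtain ⟨n, β, j, hβ, hj, rfl⟩ := h.factors b
  obtain ⟨t, h1, h2, h3⟩ := h.lifts α (i ≫ f) β (j ≫ g) hα hβ (I.comp_mem _ _ hi hf)
    (I.comp_mem _ _ hj hg) (by simpa using e)
  have sq' : wideHom (t ≫ i) (I.comp_mem _ _ h3.1 hi) ≫ wideHom f hf =
      wideHom j hj ≫ wideHom g hg :=
    WideSubcategory.hom_ext I (show (t ≫ i) ≫ f = j ≫ g by simpa using h2)
  obtain ⟨l, hl1, hl2⟩ := sq.exists_lift _ _ sq'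
  have e1 : l.hom ≫ g' = t ≫ i := congrArg InducedWideCategory.Hom.hom hl1
  have e2 : l.hom ≫ f' = j := congrArg InducedWideCategory.Hom.hom hl2
  exact ⟨β ≫ l.hom, by rw [Category.assoc, e1, ← h1, Category.assoc],
    by rw [Category.assoc, e2]⟩

theorem isoIn_of_comp (h : AdmitsConjugation I A)
    {x y z : U} {t : x ⟶ y} {s : y ⟶ x} (h1 : t ≫ s = 𝟙 x) (h2 : s ≫ t = 𝟙 y)
    {i : y ⟶ z} (hi : I i) (hti : I (t ≫ i)) : IsoIn I t :=
  ⟨h.of_comp_I hi hti, s, h.of_comp_I hti (by rw [reassoc_of% h2]; exact hi), h1, h2⟩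

theorem rep_equiv_of_span (h : AdmitsConjugation I A)
    {a b : U} {x y : Rep I A a b} (t : x.dom ⟶ y.dom) (s : y.dom ⟶ x.dom)
    (h1 : t ≫ s = 𝟙 _) (h2 : s ≫ t = 𝟙 _) (e : t ≫ y.i = x.i) (e' : t ≫ y.u = x.u) :
    x.Equiv y := by
  have ht : IsoIn I t := h.isoIn_of_comp h1 h2 y.hi (by rw [e]; exact x.hi)
  obtain ⟨r, r1, r2, r3⟩ := h.lifts (t ≫ y.α) y.j x.α x.j
    (A.comp_mem _ _ (h.iso_le _ ht).1 y.hα) x.hα y.hj x.hj (by simpa [Rep.u] using e')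
  exact ⟨t, r, ht, r3, e, r1.symm, r2⟩

end AdmitsConjugation

theorem Rep.Equiv.span {a b : U} {x y : Rep I A a b} (hxy : x.Equiv y) :
    ∃ (t : x.dom ⟶ y.dom) (s : y.dom ⟶ x.dom), t ≫ s = 𝟙 _ ∧ s ≫ t = 𝟙 _ ∧
      t ≫ y.i = x.i ∧ t ≫ y.u = x.u := by
  obtain ⟨φ, ψ, ⟨-, s, -, h1, h2⟩, -, e1, e2, e3⟩ := hxy
  exact ⟨φ, s, h1, h2, e1, by rw [Rep.u, Rep.u, ← e3, reassoc_of% e2]⟩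

variable [I.IsMultiplicative] [A.IsMultiplicative]

theorem Rep.equivalence (h : AdmitsConjugation I A) (a b : U) :
    Equivalence (Rep.Equiv (I := I) (A := A) (a := a) (b := b)) where
  refl x := h.rep_equiv_of_span (𝟙 _) (𝟙 _) (by simp) (by simp) (by simp) (by simp)
  symm {x y} hxy := by
    obtain ⟨t, s, h1, h2, e1, e2⟩ := hxy.span
    exact h.rep_equiv_of_span s t h2 h1 (by rw [← e1, reassoc_of% h2])
      (by rw [← e2, reassoc_of% h2])
  trans {x y z} hxy hyz := by
    obtain ⟨t, s, h1, h2, e1, e2⟩ := hxy.span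
    obtain ⟨t', s', h1', h2', e1', e2'⟩ := hyz.span
    exact h.rep_equiv_of_span (t ≫ t') (s' ≫ s) (by simp [reassoc_of% h1', h1])
      (by simp [reassoc_of% h2, h2']) (by simp [e1', e1]) (by simp [e2', e2])

/-- `z` is a composite of `x` (first) and `y` (second): one pulls back `x.j` along `y.i` in the
indexing category `I`, pulls back `x.α` along the resulting morphism of `I`, and factors the
composite of the other leg with `y.α` as a morphism of `A` followed by one of `I`. -/
def Rep.IsComposite {a b c : U} (x : Rep I A a b) (y : Rep I A b c) (z : Rep I A a c) : Prop :=
  ∃ (q : U) (k' : q ⟶ x.cod) (j' : q ⟶ y.dom) (hk' : I k') (hj' : I j')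
    (k'' : z.dom ⟶ x.dom) (α' : z.dom ⟶ q) (γ' : q ⟶ z.cod) (j'' : z.cod ⟶ y.cod),
    IsPullback (wideHom k' hk') (wideHom j' hj') (wideHom x.j x.hj) (wideHom y.i y.hi) ∧
    I k'' ∧ A α' ∧ IsPullback k'' α' x.α k' ∧
    A γ' ∧ I j'' ∧ γ' ≫ j'' = j' ≫ y.α ∧
    z.i = k'' ≫ x.i ∧ z.α = α' ≫ γ' ∧ z.j = j'' ≫ y.j

theorem Rep.exists_isComposite (h : AdmitsConjugation I A) {a b c : U} (x : Rep I A a b)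
    (y : Rep I A b c) : ∃ z, x.IsComposite y z := by
  obtain ⟨q, k', j', hk', hj', sq⟩ := h.exists_pullback_I x.j y.i x.hj y.hi
  obtain ⟨p, k'', α', hk'', hα', sq'⟩ := h.pullbacks x.α k' x.hα hk'
  obtain ⟨r, γ', j'', hγ', hj'', e⟩ := h.factors (j' ≫ y.α)
  exact ⟨⟨p, r, k'' ≫ x.i, α' ≫ γ', j'' ≫ y.j, I.comp_mem _ _ hk'' x.hi, A.comp_mem _ _ hα' hγ',
    I.comp_mem _ _ hj'' y.hj⟩, q, k', j', hk', hj', k'', α', γ', j'', sq, hk'', hα', sq', hγ', hj'',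
    e, rfl, rfl, rfl⟩

theorem Rep.IsComposite.span (h : AdmitsConjugation I A) {a b c : U} {x : Rep I A a b}
    {y : Rep I A b c} {z : Rep I A a c} (hz : x.IsComposite y z) :
    ∃ (p : z.dom ⟶ x.dom) (q : z.dom ⟶ y.dom), IsPullback p q x.u y.i ∧
      p ≫ x.i = z.i ∧ q ≫ y.u = z.u := by
  obtain ⟨q, k', j', hk', hj', k'', α', γ', j'', sq, -, -, sq', -, -, e, e1, e2, e3⟩ := hz
  refine ⟨k'', α' ≫ j', (sq'.flip.paste_horiz (h.isPullback_of_wide sq).flip).flip, e1.symm, ?_⟩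
  simp only [Rep.u, e2, e3, Category.assoc, reassoc_of% e]

/-- Different choices lead to equivalent composites of equivalent diagrams. -/
theorem Rep.IsComposite.unique (h : AdmitsConjugation I A) {a b c : U} {x x' : Rep I A a b}
    {y y' : Rep I A b c} {z z' : Rep I A a c} (hx : x.Equiv x') (hy : y.Equiv y')
    (hz : x.IsComposite y z) (hz' : x'.IsComposite y' z') : z.Equiv z' := by
  obtain ⟨p, q, sq, e1, e2⟩ := hz.span h
  obtain ⟨p', q', sq', e1', e2'⟩ := hz'.span h
  obtain ⟨t, s, ts, st, f1, f2⟩ := hx.span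
  obtain ⟨t', s', ts', st', f1', f2'⟩ := hy.span
  have g1 : s ≫ x.i = x'.i := by rw [← f1, reassoc_of% st]
  have g2 : s ≫ x.u = x'.u := by rw [← f2, reassoc_of% st]
  have g1' : s' ≫ y.i = y'.i := by rw [← f1', reassoc_of% st']
  obtain ⟨l, l1, l2⟩ := sq'.exists_lift (p ≫ t) (q ≫ t') (by simp [f2, f1', sq.w])
  obtain ⟨m, m1, m2⟩ := sq.exists_lift (p' ≫ s) (q' ≫ s') (by simp [g2, g1', sq'.w])
  refine h.rep_equiv_of_span l m (sq.hom_ext ?_ ?_) (sq'.hom_ext ?_ ?_) ?_ ?_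
  · simp [m1, reassoc_of% l1, ts]
  · simp [m2, reassoc_of% l2, ts']
  · simp [l1, reassoc_of% m1, st]
  · simp [l2, reassoc_of% m2, st']
  · rw [← e1', reassoc_of% l1, f1, e1]
  · rw [← e2', reassoc_of% l2, f2', e2]

theorem Rep.assoc (h : AdmitsConjugation I A) {a b c d : U} {x : Rep I A a b}
    {y : Rep I A b c} {z : Rep I A c d} {xy : Rep I A a c} {yz : Rep I A b d} {l r : Rep I A a d}
    (h1 : x.IsComposite y xy) (h2 : xy.IsComposite z l) (h3 : y.IsComposite z yz)
    (h4 : x.IsComposite yz r) : l.Equiv r := by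
  obtain ⟨p1, q1, s1, e1, f1⟩ := h1.span h
  obtain ⟨p2, q2, s2, e2, f2⟩ := h2.span h
  obtain ⟨p3, q3, s3, e3, f3⟩ := h3.span h
  obtain ⟨p4, q4, s4, e4, f4⟩ := h4.span h
  have w1 := s1.w
  have w2 := s2.w
  have w3 := s3.w
  have w4 := s4.w
  rw [← f1] at w2
  rw [← e3] at w4
  obtain ⟨m, m1, m2⟩ := s3.exists_lift (p2 ≫ q1) q2 (by simpa using w2)
  obtain ⟨t, t1, t2⟩ := s4.exists_lift (p2 ≫ p1) m
    (by rw [← e3, reassoc_of% m1, Category.assoc, w1])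
  obtain ⟨n, n1, n2⟩ := s1.exists_lift p4 (q4 ≫ p3) (by simpa using w4)
  obtain ⟨s, s1', s2'⟩ := s2.exists_lift n (q4 ≫ q3)
    (by rw [← f1, reassoc_of% n2, w3, Category.assoc])
  refine h.rep_equiv_of_span t s (s2.hom_ext (s1.hom_ext ?_ ?_) ?_)
    (s4.hom_ext ?_ (s3.hom_ext ?_ ?_)) ?_ ?_
  · simp [s1', n1, t1]
  · simp [s1', n2, reassoc_of% t2, m1]
  · simp [s2', reassoc_of% t2, m2]
  · simp [t1, reassoc_of% s1', n1]
  · simp [t2, m1, reassoc_of% s1', n2]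
  · simp [t2, m2, s2']
  · rw [← e4, reassoc_of% t1, e1, e2]
  · rw [← f4, reassoc_of% t2, ← f3, reassoc_of% m2, f2]

/-- The diagram `a ← a → c → b` with first leg the identity. -/
def Rep.reg {a b c : U} (α : a ⟶ c) (j : c ⟶ b) (hα : A α) (hj : I j) : Rep I A a b :=
  ⟨a, c, 𝟙 a, α, j, I.id_mem a, hα, hj⟩

/-- The three-fold diagram consisting of identities. -/
def Rep.id (I A : MorphismProperty U) [I.IsMultiplicative] [A.IsMultiplicative] (a : U) :
    Rep I A a a :=
  ⟨a, a, 𝟙 a, 𝟙 a, 𝟙 a, I.id_mem a, A.id_mem a, I.id_mem a⟩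

/-- The setoid of three-fold diagrams from `a` to `b`. -/
def Rep.setoid (h : AdmitsConjugation I A) (a b : U) : Setoid (Rep I A a b) :=
  ⟨Rep.Equiv, Rep.equivalence h a b⟩

/-- A chosen composite of two diagrams. -/
def Rep.comp (h : AdmitsConjugation I A) {a b c : U} (x : Rep I A a b) (y : Rep I A b c) :
    Rep I A a c :=
  (Rep.exists_isComposite h x y).choose

theorem Rep.comp_spec (h : AdmitsConjugation I A) {a b c : U} (x : Rep I A a b)
    (y : Rep I A b c) : x.IsComposite y (Rep.comp h x y) :=
  (Rep.exists_isComposite h x y).choose_spec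

theorem Rep.id_comp (h : AdmitsConjugation I A) {a b : U} (x : Rep I A a b) :
    (Rep.comp h (Rep.id I A a) x).Equiv x := by
  obtain ⟨p, q, sq, e, f⟩ := (Rep.comp_spec h (Rep.id I A a) x).span h
  have e0 : (Rep.id I A a).u = 𝟙 a := Category.comp_id _
  rw [e0] at sq
  have e' : p = (Rep.comp h (Rep.id I A a) x).i := by
    rw [← e]; exact (Category.comp_id p).symm
  have w : p = q ≫ x.i := by rw [← sq.w]; exact (Category.comp_id p).symm
  obtain ⟨m, m1, m2⟩ := sq.exists_lift x.i (𝟙 _) (by rw [Category.id_comp]; exact Category.comp_id _)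
  refine h.rep_equiv_of_span q m (sq.hom_ext ?_ ?_) m2 (w.symm.trans e') f
  · rw [Category.assoc, m1, Category.id_comp, w]
    rfl
  · rw [Category.assoc, m2, Category.id_comp, Category.comp_id]

theorem Rep.comp_id (h : AdmitsConjugation I A) {a b : U} (x : Rep I A a b) :
    (Rep.comp h x (Rep.id I A b)).Equiv x := by
  obtain ⟨p, q, sq, e, f⟩ := (Rep.comp_spec h x (Rep.id I A b)).span h
  have e0 : (Rep.id I A b).u = 𝟙 b := Category.comp_id _
  rw [e0] at f
  have w : p ≫ x.u = q := by rw [sq.w]; exact Category.comp_id q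
  obtain ⟨m, m1, m2⟩ := sq.exists_lift (𝟙 _) x.u (by rw [Category.id_comp]; exact (Category.comp_id _).symm)
  refine h.rep_equiv_of_span p m (sq.hom_ext ?_ ?_) m1 e (by rw [w, ← f]; exact (Category.comp_id q).symm)
  · rw [Category.assoc, m1, Category.id_comp, Category.comp_id]
  · rw [Category.assoc, m2, Category.id_comp]
    exact w

/-- The category `I ∘ A ∘ I^op` attached to a factorization admitting conjugation. It has the
same objects as `U`. -/
structure ThreeFold (h : AdmitsConjugation I A) where
  obj : U

/-- Morphisms of `I ∘ A ∘ I^op` are equivalence classes of three-fold diagrams. -/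
instance ThreeFold.category (h : AdmitsConjugation I A) : SmallCategory (ThreeFold h) where
  Hom X Y := Quotient (Rep.setoid h X.obj Y.obj)
  id X := Quotient.mk (Rep.setoid h X.obj X.obj) (Rep.id I A X.obj)
  comp {X Y Z} := Quotient.map₂ (sa := Rep.setoid h X.obj Y.obj) (sb := Rep.setoid h Y.obj Z.obj)
    (sc := Rep.setoid h X.obj Z.obj) (Rep.comp h) (fun _ _ hx _ _ hy ↦
      Rep.IsComposite.unique h hx hy (Rep.comp_spec h _ _) (Rep.comp_spec h _ _))
  id_comp := by
    rintro X Y ⟨x⟩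
    exact Quotient.sound (s := Rep.setoid h X.obj Y.obj) (Rep.id_comp h x)
  comp_id := by
    rintro X Y ⟨x⟩
    exact Quotient.sound (s := Rep.setoid h X.obj Y.obj) (Rep.comp_id h x)
  assoc := by
    rintro X Y Z W ⟨x⟩ ⟨y⟩ ⟨z⟩
    exact Quotient.sound (s := Rep.setoid h X.obj W.obj) (Rep.assoc h (Rep.comp_spec h _ _)
      (Rep.comp_spec h _ _) (Rep.comp_spec h _ _) (Rep.comp_spec h _ _))

namespace ThreeFold

variable (h : AdmitsConjugation I A)

/-- The morphism `j ∘ α ∘ i^*` of `I ∘ A ∘ I^op` represented by a three-fold diagram. -/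
def homMk {X Y : ThreeFold h} (x : Rep I A X.obj Y.obj) : X ⟶ Y :=
  Quotient.mk (Rep.setoid h X.obj Y.obj) x

variable {h}

theorem homMk_surj {X Y : ThreeFold h} (f : X ⟶ Y) : ∃ x, homMk h x = f := Quotient.exists_rep f

theorem homMk_eq_iff {X Y : ThreeFold h} {x y : Rep I A X.obj Y.obj} : homMk h x = homMk h y ↔ x.Equiv y :=
  ⟨fun e ↦ Quotient.exact (s := Rep.setoid h X.obj Y.obj) e,
    fun e ↦ Quotient.sound (s := Rep.setoid h X.obj Y.obj) e⟩

theorem homMk_comp {X Y Z : ThreeFold h} {x : Rep I A X.obj Y.obj} {y : Rep I A Y.obj Z.obj}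
    {z : Rep I A X.obj Z.obj} (hz : x.IsComposite y z) : homMk h x ≫ homMk h y = homMk h z :=
  homMk_eq_iff.2 (Rep.IsComposite.unique h ((Rep.equivalence h _ _).refl x)
    ((Rep.equivalence h _ _).refl y) (Rep.comp_spec h x y) hz)

theorem homMk_comp_span {X Y Z : ThreeFold h} (x : Rep I A X.obj Y.obj) (y : Rep I A Y.obj Z.obj) :
    ∃ (z : Rep I A X.obj Z.obj) (p : z.dom ⟶ x.dom) (q : z.dom ⟶ y.dom),
      homMk h x ≫ homMk h y = homMk h z ∧ IsPullback p q x.u y.i ∧ p ≫ x.i = z.i ∧ q ≫ y.u = z.u := by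
  obtain ⟨p, q, sq, e1, e2⟩ := (Rep.comp_spec h x y).span h
  exact ⟨_, p, q, homMk_comp (Rep.comp_spec h x y), sq, e1, e2⟩

variable (h)

/-- The morphism of `I ∘ A ∘ I^op` given by a morphism of `U`: the class of the diagrams
`a ← a → c → b` with first leg the identity, for a factorization of the given morphism. -/
def ofHom {a b : U} (f : a ⟶ b) : (⟨a⟩ : ThreeFold h) ⟶ ⟨b⟩ :=
  homMk h (Rep.reg (h.factors f).choose_spec.choose (h.factors f).choose_spec.choose_spec.choose
    (h.factors f).choose_spec.choose_spec.choose_spec.1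
    (h.factors f).choose_spec.choose_spec.choose_spec.2.1)

theorem ofHom_eq {a b c : U} (α : a ⟶ c) (j : c ⟶ b) (hα : A α) (hj : I j) (f : a ⟶ b)
    (hf : α ≫ j = f) : ofHom h f = homMk h (Rep.reg α j hα hj) := by
  have hh := (h.factors f).choose_spec.choose_spec.choose_spec.2.2
  refine homMk_eq_iff.2 (h.rep_equiv_of_span (𝟙 a) (𝟙 a) (Category.comp_id _) (Category.comp_id _)
    (Category.comp_id _) ((Category.id_comp _).trans (hf.trans hh.symm)))

theorem homMk_eq_ofHom {X Y : ThreeFold h} (x : Rep I A X.obj Y.obj) (f : X.obj ⟶ Y.obj) :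
    homMk h x = ofHom h f ↔ IsIso x.i ∧ x.u = x.i ≫ f := by
  obtain ⟨c, α, j, hα, hj, e⟩ := h.factors f
  rw [ofHom_eq h α j hα hj f e, homMk_eq_iff]
  constructor
  · intro hx
    obtain ⟨t, s, h1, h2, e1, e2⟩ := hx.span
    have e1' : t = x.i := (Category.comp_id t).symm.trans e1
    subst e1'
    refine ⟨⟨s, h1, h2⟩, e2.symm.trans ?_⟩
    rw [← e]
    exact congrArg (x.i ≫ ·) rfl
  · rintro ⟨⟨s, h1, h2⟩, hu⟩
    refine h.rep_equiv_of_span x.i s h1 h2 (Category.comp_id x.i) ?_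
    rw [hu, ← e]
    rfl

theorem ofHom_comp_span {X Y Z : ThreeFold h} (f : X.obj ⟶ Y.obj) (y : Rep I A Y.obj Z.obj) :
    ∃ (z : Rep I A X.obj Z.obj) (q : z.dom ⟶ y.dom),
      (ofHom h f : X ⟶ Y) ≫ homMk h y = homMk h z ∧ IsPullback z.i q f y.i ∧ q ≫ y.u = z.u := by
  obtain ⟨c, α, j, hα, hj, e⟩ := h.factors f
  obtain ⟨z, p, q, e1, sq, e2, e3⟩ :=
    homMk_comp_span (X := X) (Y := Y) (Z := Z) (Rep.reg α j hα hj) y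
  have e2' : p = z.i := (Category.comp_id p).symm.trans e2
  subst e2'
  refine ⟨z, q, ?_, ?_, e3⟩
  · rw [← e1, ofHom_eq h α j hα hj f e]
  · rw [← e]; exact sq

/-- The category `U = I ∘ A` as a subcategory of `I ∘ A ∘ I^op`. -/
def ofU : U ⥤ ThreeFold h where
  obj a := ⟨a⟩
  map f := ofHom h f
  map_id a := ((homMk_eq_ofHom h (X := ⟨a⟩) (Y := ⟨a⟩) (Rep.id I A a) (𝟙 a)).2
    ⟨inferInstanceAs (IsIso (𝟙 a)), rfl⟩).symm
  map_comp {a b c} f g := by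
    obtain ⟨m, α, j, hα, hj, e⟩ := h.factors g
    obtain ⟨z, q, e1, sq, e2⟩ := ofHom_comp_span h (X := ⟨a⟩) (Y := ⟨b⟩) (Z := ⟨c⟩) f
      (Rep.reg α j hα hj)
    rw [ofHom_eq h α j hα hj g e, e1, eq_comm, homMk_eq_ofHom]
    have e' : (Rep.reg α j hα hj).u = g := e
    have w : z.i ≫ f = q := sq.w.trans (Category.comp_id q)
    refine ⟨sq.isIso_fst_of_isIso (inferInstanceAs (IsIso (𝟙 b))), ?_⟩
    rw [← e2, e', ← w]
    exact Category.assoc _ _ _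

variable {h}

/-- The regular morphisms of `I ∘ A ∘ I^op` are those lying in the subcategory `U = I ∘ A`. The
other morphisms are called singular. -/
def IsRegular {X Y : ThreeFold h} (f : X ⟶ Y) : Prop :=
  ∃ g : X.obj ⟶ Y.obj, f = (ofU h).map g

theorem isRegular_homMk_iff {X Y : ThreeFold h} (x : Rep I A X.obj Y.obj) :
    IsRegular (homMk h x) ↔ IsIso x.i := by
  constructor
  · rintro ⟨g, hg⟩
    exact ((homMk_eq_ofHom h x g).1 hg).1
  · intro hx
    exact ⟨inv x.i ≫ x.u, (homMk_eq_ofHom h x _).2 ⟨hx, by simp⟩⟩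

theorem isIso_of_section {x y : U} {i : x ⟶ y} (hi : I i) (s : y ⟶ x) (e : s ≫ i = 𝟙 y)
    (h : AdmitsConjugation I A) : IsIso i := by
  have := h.mono_of_I hi
  exact ⟨s, by rw [← cancel_mono i, Category.assoc, e, Category.comp_id, Category.id_comp], e⟩

theorem IsRegular.of_comp_left {X Y Z : ThreeFold h} (α : X.obj ⟶ Y.obj) (hα : A α) (γ : Y ⟶ Z)
    (hr : IsRegular ((ofU h).map α ≫ γ : X ⟶ Z)) : IsRegular γ := by
  obtain ⟨y, rfl⟩ := homMk_surj γ
  obtain ⟨z, q, e, sq, -⟩ := ofHom_comp_span h (X := X) (Y := Y) (Z := Z) α y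
  have hz : IsIso z.i := by
    rw [← isRegular_homMk_iff, ← e]
    exact hr
  obtain ⟨m, β, j, hβ, hj, e'⟩ := h.factors (inv z.i ≫ q)
  obtain ⟨t, -, h2, -⟩ := h.lifts (β : X.obj ⟶ m) (j ≫ y.i) α (𝟙 _) hβ hα
    (I.comp_mem _ _ hj y.hi) (I.id_mem _) (by
      rw [← Category.assoc, e', Category.assoc, ← sq.w, IsIso.inv_hom_id_assoc, Category.comp_id])
  rw [isRegular_homMk_iff]
  exact isIso_of_section y.hi (t ≫ j) (by rw [Category.assoc, h2]) h

theorem IsRegular.of_comp_right {X Y Z : ThreeFold h} (σ : X ⟶ Y) (β : Y ⟶ Z)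
    (hr : IsRegular (σ ≫ β)) : IsRegular σ := by
  obtain ⟨x, rfl⟩ := homMk_surj σ
  obtain ⟨y, rfl⟩ := homMk_surj β
  obtain ⟨z, p, q, e, sq, e1, -⟩ := homMk_comp_span x y
  have hz : IsIso z.i := by
    rw [← isRegular_homMk_iff, ← e]
    exact hr
  rw [isRegular_homMk_iff]
  exact isIso_of_section x.hi (inv z.i ≫ p) (by rw [Category.assoc, e1, IsIso.inv_hom_id]) h

/-! ### The regular bimodule -/

/-- The based set `U(X, Y)_+ = B(X, Y) / S(X, Y)`, where `B = I ∘ A ∘ I^op` and `S(X, Y)` is the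
set of singular morphisms: the regular morphisms together with a disjoint base point `none`. -/
def Plus (X Y : ThreeFold h) : Pointed.{w} :=
  Pointed.of (none : Option {f : X ⟶ Y // IsRegular f})

open Classical in
/-- The quotient map `B(X, Y) → U(X, Y)_+`; it sends singular morphisms to the base point. -/
def toPlus {X Y : ThreeFold h} (f : X ⟶ Y) : Option {f : X ⟶ Y // IsRegular f} :=
  if hf : IsRegular f then some ⟨f, hf⟩ else none

theorem toPlus_val {X Y : ThreeFold h} (f : {f : X ⟶ Y // IsRegular f}) :
    toPlus f.1 = some f := dif_pos f.2

theorem toPlus_bind {X Y X' Y' : ThreeFold h} (F : (X ⟶ Y) → (X' ⟶ Y'))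
    (hF : ∀ f, IsRegular (F f) → IsRegular f) (f : X ⟶ Y) :
    ((toPlus f).bind fun g ↦ toPlus (F g.1)) = toPlus (F f) := by
  by_cases hf : IsRegular f
  · simp [toPlus, hf]
  · have : ¬ IsRegular (F f) := fun e ↦ hf (hF f e)
    simp [toPlus, hf, this]

/-- The map `U(X, Y)_+ → U(X', Y')_+` induced by a map `B(X, Y) → B(X', Y')`. -/
def plusMap {X Y X' Y' : ThreeFold h} (F : (X ⟶ Y) → (X' ⟶ Y')) : Plus X Y ⟶ Plus X' Y' :=
  ⟨fun o ↦ Option.bind o fun g ↦ toPlus (F g.1), rfl⟩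

theorem plusMap_id {X Y : ThreeFold h} (F : (X ⟶ Y) → (X ⟶ Y)) (hF : ∀ f, F f = f) :
    plusMap F = 𝟙 _ := by
  apply Pointed.Hom.ext
  funext o
  cases o with
  | none => rfl
  | some g => exact (congrArg toPlus (hF g.1)).trans (toPlus_val g)

theorem plusMap_comp {X Y X' Y' X'' Y'' : ThreeFold h} (F : (X ⟶ Y) → (X' ⟶ Y'))
    (G : (X' ⟶ Y') → (X'' ⟶ Y'')) (K : (X ⟶ Y) → (X'' ⟶ Y'')) (hK : ∀ f, K f = G (F f))
    (hG : ∀ f, IsRegular (G f) → IsRegular f) :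
    plusMap K = plusMap F ≫ plusMap G := by
  apply Pointed.Hom.ext
  funext o
  cases o with
  | none => rfl
  | some g => exact (congrArg toPlus (hK g.1)).trans (toPlus_bind G hG (F g.1)).symm

variable (h)

/-- The regular bimodule `U_+ : A^op × B → Sets_*` (in curried form), `(a, b) ↦ U(a, b)_+`. -/
def regularBimodule : (WideSubcategory A)ᵒᵖ ⥤ ThreeFold h ⥤ Pointed.{w} where
  obj a :=
    { obj := fun Y ↦ Plus (⟨a.unop.obj⟩ : ThreeFold h) Y
      map := fun β ↦ plusMap fun γ ↦ γ ≫ β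
      map_id := fun _ ↦ plusMap_id _ fun _ ↦ Category.comp_id _
      map_comp := fun β β' ↦ plusMap_comp _ _ _ (fun _ ↦ (Category.assoc _ _ _).symm)
        (fun _ ↦ IsRegular.of_comp_right _ _) }
  map {a a'} α :=
    { app := fun Y ↦ plusMap fun γ ↦ (ofU h).map α.unop.hom ≫ γ
      naturality := fun Y Y' β ↦
        (plusMap_comp _ _ (fun γ ↦ (ofU h).map α.unop.hom ≫ γ ≫ β) (fun _ ↦ rfl)
          (fun _ ↦ IsRegular.of_comp_left (X := ⟨a'.unop.obj⟩) (Y := ⟨a.unop.obj⟩) α.unop.hom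
            α.unop.property _)).symm.trans
        (plusMap_comp _ _ _ (fun _ ↦ (Category.assoc _ _ _).symm)
          (fun _ ↦ IsRegular.of_comp_right _ _)) }
  map_id a := by
    ext Y : 2
    exact plusMap_id _ fun γ ↦
      (congrArg (· ≫ γ) ((ofU h).map_id _)).trans (Category.id_comp γ)
  map_comp {a a' a''} α α' := by
    ext Y : 2
    exact plusMap_comp _ _ _ (fun γ ↦ (congrArg (· ≫ γ)
      ((ofU h).map_comp α'.unop.hom α.unop.hom)).trans (Category.assoc _ _ _))
      (fun _ ↦ IsRegular.of_comp_left (X := ⟨a''.unop.obj⟩) (Y := ⟨a'.unop.obj⟩)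
        α'.unop.hom α'.unop.property _)

end ThreeFold

end

/-! ### The adjoint pair attached to a bimodule -/

section Copowers

variable {C : Type u} [Category.{v} C] [HasZeroMorphisms C] [HasCoproducts.{w} C]

/-- `X ⊗ S`: the coproduct of copies of `X`, one for each element of the based set `S` other than
the base point. -/
def copower (X : C) (S : Pointed.{w}) : C := ∐ fun _ : {s : S.X // s ≠ S.point} ↦ X

open Classical in
/-- The inclusion `X → X ⊗ S` of the summand indexed by `s`; it is zero for the base point. -/
def copower.ι (X : C) (S : Pointed.{w}) (s : S.X) : X ⟶ copower X S :=
  if hs : s ≠ S.point then Sigma.ι (fun _ : {s : S.X // s ≠ S.point} ↦ X) ⟨s, hs⟩ else 0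

/-- The morphism out of `X ⊗ S` with prescribed components. -/
def copower.desc {X Y : C} {S : Pointed.{w}} (f : S.X → (X ⟶ Y)) : copower X S ⟶ Y :=
  Sigma.desc fun s ↦ f s.1

theorem copower.ι_point (X : C) (S : Pointed.{w}) : copower.ι X S S.point = 0 := by simp [copower.ι]

theorem copower.ι_ne (X : C) (S : Pointed.{w}) (s : {s : S.X // s ≠ S.point}) :
    copower.ι X S s.1 = Sigma.ι (fun _ : {s : S.X // s ≠ S.point} ↦ X) s := dif_pos s.2

theorem copower.ι_desc {X Y : C} {S : Pointed.{w}} (f : S.X → (X ⟶ Y)) (hf : f S.point = 0)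
    (s : S.X) : copower.ι X S s ≫ copower.desc f = f s := by
  by_cases hs : s = S.point
  · subst hs; rw [copower.ι_point, hf, zero_comp]
  · exact (congrArg (· ≫ copower.desc f) (copower.ι_ne X S ⟨s, hs⟩)).trans (Sigma.ι_desc _ _)

theorem copower.hom_ext {X Y : C} {S : Pointed.{w}} {f g : copower X S ⟶ Y}
    (e : ∀ s, copower.ι X S s ≫ f = copower.ι X S s ≫ g) : f = g := by
  refine Sigma.hom_ext _ _ fun s ↦ ?_
  rw [← copower.ι_ne]
  exact e s.1

/-- Functoriality of `X ⊗ S` in the based set `S`. -/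
def copower.map (X : C) {S T : Pointed.{w}} (f : S ⟶ T) : copower X S ⟶ copower X T :=
  copower.desc fun s ↦ copower.ι X T (f.toFun s)

theorem copower.ι_map (X : C) {S T : Pointed.{w}} (f : S ⟶ T) (s : S.X) :
    copower.ι X S s ≫ copower.map X f = copower.ι X T (f.toFun s) :=
  copower.ι_desc _ (by rw [f.map_point, copower.ι_point]) s

/-- Functoriality of `X ⊗ S` in `X`. -/
def copower.app {X Y : C} (φ : X ⟶ Y) (S : Pointed.{w}) : copower X S ⟶ copower Y S :=
  copower.desc fun s ↦ φ ≫ copower.ι Y S s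

theorem copower.ι_app {X Y : C} (φ : X ⟶ Y) (S : Pointed.{w}) (s : S.X) :
    copower.ι X S s ≫ copower.app φ S = φ ≫ copower.ι Y S s :=
  copower.ι_desc (fun s ↦ φ ≫ copower.ι Y S s) (by rw [copower.ι_point, comp_zero]) s

/-- The functor `(X, S) ↦ X ⊗ S`. -/
def copowerFunctor : C ⥤ Pointed.{w} ⥤ C where
  obj X :=
    { obj := fun S ↦ copower X S
      map := fun f ↦ copower.map X f
      map_id := fun S ↦ copower.hom_ext fun s ↦
        (copower.ι_map X (𝟙 S) s).trans (Category.comp_id _).symm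
      map_comp := fun f g ↦ copower.hom_ext fun s ↦ by
        rw [copower.ι_map, ← Category.assoc, copower.ι_map, copower.ι_map]
        rfl }
  map φ :=
    { app := fun S ↦ copower.app φ S
      naturality := fun S T f ↦ copower.hom_ext fun s ↦ by
        rw [← Category.assoc, copower.ι_map, ← Category.assoc, copower.ι_app, copower.ι_app,
          Category.assoc, copower.ι_map] }
  map_id X := by
    ext S : 2
    exact copower.hom_ext fun s ↦ (copower.ι_app (𝟙 X) S s).trans
      ((Category.id_comp _).trans (Category.comp_id _).symm)
  map_comp {X Y Z} φ ψ := by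
    ext S : 2
    refine copower.hom_ext fun s ↦ (copower.ι_app (φ ≫ ψ) S s).trans ?_
    refine Eq.trans ?_ (Category.assoc _ (copower.app φ S) (copower.app ψ S))
    rw [copower.ι_app, Category.assoc, Category.assoc, copower.ι_app]

end Copowers

section Powers

variable {C : Type u} [Category.{v} C] [HasZeroMorphisms C] [HasProducts.{w} C]

/-- `∏_S X`: the product of copies of `X`, one for each element of the based set `S` other than
the base point. -/
def power (X : C) (S : Pointed.{w}) : C := ∏ᶜ fun _ : {s : S.X // s ≠ S.point} ↦ X

open Classical in
/-- The projection of `∏_S X` to the factor indexed by `s`; it is zero for the base point. -/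
def power.π (X : C) (S : Pointed.{w}) (s : S.X) : power X S ⟶ X :=
  if hs : s ≠ S.point then Pi.π (fun _ : {s : S.X // s ≠ S.point} ↦ X) ⟨s, hs⟩ else 0

/-- The morphism into `∏_S X` with prescribed components. -/
def power.lift {X Y : C} {S : Pointed.{w}} (f : S.X → (Y ⟶ X)) : Y ⟶ power X S :=
  Pi.lift fun s ↦ f s.1

theorem power.π_point (X : C) (S : Pointed.{w}) : power.π X S S.point = 0 := by simp [power.π]

theorem power.π_ne (X : C) (S : Pointed.{w}) (s : {s : S.X // s ≠ S.point}) :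
    power.π X S s.1 = Pi.π (fun _ : {s : S.X // s ≠ S.point} ↦ X) s := dif_pos s.2

theorem power.lift_π {X Y : C} {S : Pointed.{w}} (f : S.X → (Y ⟶ X)) (hf : f S.point = 0)
    (s : S.X) : power.lift f ≫ power.π X S s = f s := by
  by_cases hs : s = S.point
  · subst hs; rw [power.π_point, hf, comp_zero]
  · exact (congrArg (power.lift f ≫ ·) (power.π_ne X S ⟨s, hs⟩)).trans (Pi.lift_π _ _)

theorem power.hom_ext {X Y : C} {S : Pointed.{w}} {f g : Y ⟶ power X S}
    (e : ∀ s, f ≫ power.π X S s = g ≫ power.π X S s) : f = g := by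
  refine Pi.hom_ext _ _ fun s ↦ ?_
  rw [← power.π_ne]
  exact e s.1

/-- Contravariant functoriality of `∏_S X` in the based set `S`. -/
def power.map (X : C) {S T : Pointed.{w}} (f : S ⟶ T) : power X T ⟶ power X S :=
  power.lift fun s ↦ power.π X T (f.toFun s)

theorem power.map_π (X : C) {S T : Pointed.{w}} (f : S ⟶ T) (s : S.X) :
    power.map X f ≫ power.π X S s = power.π X T (f.toFun s) :=
  power.lift_π _ (by rw [f.map_point, power.π_point]) s

/-- Functoriality of `∏_S X` in `X`. -/
def power.app {X Y : C} (φ : X ⟶ Y) (S : Pointed.{w}) : power X S ⟶ power Y S :=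
  power.lift fun s ↦ power.π X S s ≫ φ

theorem power.app_π {X Y : C} (φ : X ⟶ Y) (S : Pointed.{w}) (s : S.X) :
    power.app φ S ≫ power.π Y S s = power.π X S s ≫ φ :=
  power.lift_π (fun s ↦ power.π X S s ≫ φ) (by rw [power.π_point, zero_comp]) s

/-- The functor `(X, S) ↦ ∏_S X`, contravariant in the based set `S`. -/
def powerFunctor : C ⥤ Pointed.{w}ᵒᵖ ⥤ C where
  obj X :=
    { obj := fun S ↦ power X S.unop
      map := fun f ↦ power.map X f.unop
      map_id := fun S ↦ power.hom_ext fun s ↦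
        (power.map_π X (𝟙 S.unop) s).trans (Category.id_comp _).symm
      map_comp := fun f g ↦ power.hom_ext fun s ↦ by
        rw [power.map_π, Category.assoc, power.map_π, power.map_π]
        rfl }
  map φ :=
    { app := fun S ↦ power.app φ S.unop
      naturality := fun S T f ↦ power.hom_ext fun s ↦ by
        rw [Category.assoc, power.app_π, Category.assoc, power.map_π, power.app_π, ← Category.assoc,
          power.map_π] }
  map_id X := by
    ext S : 2
    exact power.hom_ext fun s ↦ (power.app_π (𝟙 X) S.unop s).trans
      ((Category.comp_id _).trans (Category.id_comp _).symm)
  map_comp {X Y Z} φ ψ := by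
    ext S : 2
    refine power.hom_ext fun s ↦ (power.app_π (φ ≫ ψ) S.unop s).trans ?_
    refine Eq.trans ?_ (Category.assoc (power.app φ S.unop) (power.app ψ S.unop) _).symm
    rw [power.app_π, ← Category.assoc, ← Category.assoc, power.app_π]

end Powers

section

variable {A B : Type w} [SmallCategory A] [SmallCategory B]
variable {C : Type u} [Category.{v} C] [HasZeroMorphisms C]

section Tensor

variable [HasColimitsOfSize.{w, w} C]

/-- The functor `B^op × B → C` (in curried form) given by `(x, y) ↦ F(x) ⊗ Q(y)`. -/
def tensorIntegrand (F : Bᵒᵖ ⥤ C) (Q : B ⥤ Pointed.{w}) : Bᵒᵖ ⥤ B ⥤ C :=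
  F ⋙ copowerFunctor ⋙ (Functor.whiskeringLeft B Pointed.{w} C).obj Q

namespace tensorIntegrand

/-- Functoriality of `F(x) ⊗ Q(y)` in `F`. -/
def mapLeft {F F' : Bᵒᵖ ⥤ C} (φ : F ⟶ F') (Q : B ⥤ Pointed.{w}) :
    tensorIntegrand F Q ⟶ tensorIntegrand F' Q :=
  Functor.whiskerRight φ (copowerFunctor ⋙ (Functor.whiskeringLeft B Pointed.{w} C).obj Q)

/-- Functoriality of `F(x) ⊗ Q(y)` in `Q`. -/
def mapRight (F : Bᵒᵖ ⥤ C) {Q Q' : B ⥤ Pointed.{w}} (φ : Q ⟶ Q') :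
    tensorIntegrand F Q ⟶ tensorIntegrand F Q' :=
  Functor.whiskerLeft F (Functor.whiskerLeft copowerFunctor
    ((Functor.whiskeringLeft B Pointed.{w} C).map φ))

/-- The inclusion of a summand of `F(x) ⊗ Q(y)`. -/
def ι (F : Bᵒᵖ ⥤ C) (Q : B ⥤ Pointed.{w}) (x : Bᵒᵖ) (y : B) (q : (Q.obj y).X) :
    F.obj x ⟶ ((tensorIntegrand F Q).obj x).obj y :=
  copower.ι (F.obj x) (Q.obj y) q

/-- The morphism out of `F(x) ⊗ Q(y)` with prescribed components. -/
def desc {F : Bᵒᵖ ⥤ C} {Q : B ⥤ Pointed.{w}} {x : Bᵒᵖ} {y : B} {X : C}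
    (f : (Q.obj y).X → (F.obj x ⟶ X)) : ((tensorIntegrand F Q).obj x).obj y ⟶ X :=
  copower.desc f

variable (F F' : Bᵒᵖ ⥤ C) (Q Q' : B ⥤ Pointed.{w})

theorem ι_point (x : Bᵒᵖ) (y : B) : ι F Q x y (Q.obj y).point = 0 := copower.ι_point _ _

theorem hom_ext {F : Bᵒᵖ ⥤ C} {Q : B ⥤ Pointed.{w}} {x : Bᵒᵖ} {y : B} {X : C}
    {f g : ((tensorIntegrand F Q).obj x).obj y ⟶ X}
    (e : ∀ q, ι F Q x y q ≫ f = ι F Q x y q ≫ g) : f = g := copower.hom_ext e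

theorem ι_desc {F : Bᵒᵖ ⥤ C} {Q : B ⥤ Pointed.{w}} {x : Bᵒᵖ} {y : B} {X : C}
    (f : (Q.obj y).X → (F.obj x ⟶ X)) (hf : f (Q.obj y).point = 0) (q : (Q.obj y).X) :
    ι F Q x y q ≫ desc f = f q := copower.ι_desc f hf q

theorem ι_map {x x' : Bᵒᵖ} (β : x ⟶ x') (y : B) (q : (Q.obj y).X) :
    ι F Q x y q ≫ ((tensorIntegrand F Q).map β).app y = F.map β ≫ ι F Q x' y q :=
  copower.ι_app (F.map β) (Q.obj y) q

theorem ι_obj_map (x : Bᵒᵖ) {y y' : B} (β : y ⟶ y') (q : (Q.obj y).X) :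
    ι F Q x y q ≫ ((tensorIntegrand F Q).obj x).map β = ι F Q x y' ((Q.map β).toFun q) :=
  copower.ι_map (F.obj x) (Q.map β) q

variable {F F' Q Q'}

theorem ι_mapLeft (φ : F ⟶ F') (x : Bᵒᵖ) (y : B) (q : (Q.obj y).X) :
    ι F Q x y q ≫ ((mapLeft φ Q).app x).app y = φ.app x ≫ ι F' Q x y q :=
  copower.ι_app (φ.app x) (Q.obj y) q

theorem ι_mapRight (φ : Q ⟶ Q') (x : Bᵒᵖ) (y : B) (q : (Q.obj y).X) :
    ι F Q x y q ≫ ((mapRight F φ).app x).app y = ι F Q' x y ((φ.app y).toFun q) :=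
  copower.ι_map (F.obj x) (φ.app y) q

end tensorIntegrand

/-- The tensor product `F ⊗_B Q`, the coend of `F(x) ⊗ Q(y)`. -/
abbrev tensor (F : Bᵒᵖ ⥤ C) (Q : B ⥤ Pointed.{w}) : C := coend (tensorIntegrand F Q)

namespace tensor

/-- Functoriality of `F ⊗_B Q` in `F`. -/
def mapLeft {F F' : Bᵒᵖ ⥤ C} (φ : F ⟶ F') (Q : B ⥤ Pointed.{w}) : tensor F Q ⟶ tensor F' Q :=
  coend.map (tensorIntegrand.mapLeft φ Q)

/-- Functoriality of `F ⊗_B Q` in `Q`. -/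
def mapRight (F : Bᵒᵖ ⥤ C) {Q Q' : B ⥤ Pointed.{w}} (φ : Q ⟶ Q') : tensor F Q ⟶ tensor F Q' :=
  coend.map (tensorIntegrand.mapRight F φ)

/-- The structure morphism `F(b) → F ⊗_B Q` attached to `q ∈ Q(b)`. -/
def ι (F : Bᵒᵖ ⥤ C) (Q : B ⥤ Pointed.{w}) (b : B) (q : (Q.obj b).X) :
    F.obj (op b) ⟶ tensor F Q :=
  tensorIntegrand.ι F Q (op b) b q ≫ coend.ι (tensorIntegrand F Q) b

theorem ι_point (F : Bᵒᵖ ⥤ C) (Q : B ⥤ Pointed.{w}) (b : B) :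
    ι F Q b (Q.obj b).point = 0 := by
  rw [ι, tensorIntegrand.ι_point, zero_comp]

theorem condition (F : Bᵒᵖ ⥤ C) (Q : B ⥤ Pointed.{w}) {b b' : B} (β : b ⟶ b')
    (q : (Q.obj b).X) : F.map β.op ≫ ι F Q b q = ι F Q b' ((Q.map β).toFun q) := by
  rw [ι, ι, ← tensorIntegrand.ι_obj_map, Category.assoc, ← coend.condition, ← Category.assoc,
    ← Category.assoc, tensorIntegrand.ι_map]

theorem hom_ext {F : Bᵒᵖ ⥤ C} {Q : B ⥤ Pointed.{w}} {X : C} {f g : tensor F Q ⟶ X}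
    (e : ∀ b q, ι F Q b q ≫ f = ι F Q b q ≫ g) : f = g := by
  refine coend.hom_ext fun b ↦ tensorIntegrand.hom_ext fun q ↦ ?_
  simpa only [ι, Category.assoc] using e b q

theorem ι_mapLeft {F F' : Bᵒᵖ ⥤ C} (φ : F ⟶ F') (Q : B ⥤ Pointed.{w}) (b : B)
    (q : (Q.obj b).X) : ι F Q b q ≫ mapLeft φ Q = φ.app (op b) ≫ ι F' Q b q := by
  rw [ι, ι, mapLeft, Category.assoc, coend.ι_map, ← Category.assoc, tensorIntegrand.ι_mapLeft,
    Category.assoc]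

theorem ι_mapRight (F : Bᵒᵖ ⥤ C) {Q Q' : B ⥤ Pointed.{w}} (φ : Q ⟶ Q') (b : B)
    (q : (Q.obj b).X) : ι F Q b q ≫ mapRight F φ = ι F Q' b ((φ.app b).toFun q) := by
  rw [ι, ι, mapRight, Category.assoc, coend.ι_map, ← Category.assoc, tensorIntegrand.ι_mapRight]

theorem mapRight_id (F : Bᵒᵖ ⥤ C) (Q : B ⥤ Pointed.{w}) : mapRight F (𝟙 Q) = 𝟙 (tensor F Q) :=
  hom_ext fun b q ↦ (ι_mapRight F (𝟙 Q) b q).trans (Category.comp_id _).symm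

theorem mapRight_comp (F : Bᵒᵖ ⥤ C) {Q Q' Q'' : B ⥤ Pointed.{w}} (φ : Q ⟶ Q') (ψ : Q' ⟶ Q'') :
    mapRight F (φ ≫ ψ) = mapRight F φ ≫ mapRight F ψ :=
  hom_ext fun b q ↦ by
    rw [ι_mapRight, ← Category.assoc, ι_mapRight, ι_mapRight]; rfl

theorem mapLeft_id (F : Bᵒᵖ ⥤ C) (Q : B ⥤ Pointed.{w}) : mapLeft (𝟙 F) Q = 𝟙 (tensor F Q) :=
  hom_ext fun b q ↦ (ι_mapLeft (𝟙 F) Q b q).trans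
    ((Category.id_comp _).trans (Category.comp_id _).symm)

theorem mapLeft_comp {F F' F'' : Bᵒᵖ ⥤ C} (φ : F ⟶ F') (ψ : F' ⟶ F'') (Q : B ⥤ Pointed.{w}) :
    mapLeft (φ ≫ ψ) Q = mapLeft φ Q ≫ mapLeft ψ Q :=
  hom_ext fun b q ↦ by
    rw [ι_mapLeft, NatTrans.comp_app, ← Category.assoc, ι_mapLeft, Category.assoc,
      Category.assoc, ι_mapLeft]

theorem mapRight_mapLeft {F F' : Bᵒᵖ ⥤ C} (φ : F ⟶ F') {Q Q' : B ⥤ Pointed.{w}} (ψ : Q ⟶ Q') :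
    mapRight F ψ ≫ mapLeft φ Q' = mapLeft φ Q ≫ mapRight F' ψ :=
  hom_ext fun b q ↦ by
    rw [← Category.assoc, ι_mapRight, ι_mapLeft, ← Category.assoc, ι_mapLeft, Category.assoc,
      ι_mapRight]

/-- The morphism out of `F ⊗_B Q` with prescribed components. -/
def desc {F : Bᵒᵖ ⥤ C} {Q : B ⥤ Pointed.{w}} {X : C}
    (f : ∀ b : B, (Q.obj b).X → (F.obj (op b) ⟶ X)) (h0 : ∀ b, f b (Q.obj b).point = 0)
    (hf : ∀ {b b' : B} (β : b ⟶ b') (q : (Q.obj b).X),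
      F.map β.op ≫ f b q = f b' ((Q.map β).toFun q)) : tensor F Q ⟶ X :=
  coend.desc (F := tensorIntegrand F Q) (fun b ↦ tensorIntegrand.desc (f b)) fun b b' β ↦
    tensorIntegrand.hom_ext fun q ↦ by
      rw [← Category.assoc, tensorIntegrand.ι_map, ← Category.assoc, tensorIntegrand.ι_obj_map,
        Category.assoc, tensorIntegrand.ι_desc _ (h0 b), tensorIntegrand.ι_desc _ (h0 b'), hf]

theorem ι_desc {F : Bᵒᵖ ⥤ C} {Q : B ⥤ Pointed.{w}} {X : C}
    (f : ∀ b : B, (Q.obj b).X → (F.obj (op b) ⟶ X)) (h0 : ∀ b, f b (Q.obj b).point = 0)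
    (hf : ∀ {b b' : B} (β : b ⟶ b') (q : (Q.obj b).X),
      F.map β.op ≫ f b q = f b' ((Q.map β).toFun q)) (b : B) (q : (Q.obj b).X) :
    ι F Q b q ≫ desc f h0 hf = f b q := by
  rw [ι, desc, Category.assoc, coend.ι_desc, tensorIntegrand.ι_desc _ (h0 b)]

end tensor

end Tensor

section Hom

variable [HasLimitsOfSize.{w, w} C]

/-- The functor `A^op × A → C` (in curried form) given by `(x, y) ↦ ∏_{P(y)} G(x)`. -/
def homIntegrand (P : Aᵒᵖ ⥤ Pointed.{w}) (G : Aᵒᵖ ⥤ C) : Aᵒᵖ ⥤ A ⥤ C :=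
  G ⋙ powerFunctor ⋙ (Functor.whiskeringLeft A Pointed.{w}ᵒᵖ C).obj P.rightOp

namespace homIntegrand

/-- Functoriality of `∏_{P(y)} G(x)` in `G`. -/
def mapRight (P : Aᵒᵖ ⥤ Pointed.{w}) {G G' : Aᵒᵖ ⥤ C} (φ : G ⟶ G') :
    homIntegrand P G ⟶ homIntegrand P G' :=
  Functor.whiskerRight φ (powerFunctor ⋙ (Functor.whiskeringLeft A Pointed.{w}ᵒᵖ C).obj P.rightOp)

/-- Contravariant functoriality of `∏_{P(y)} G(x)` in `P`. -/
def mapLeft {P P' : Aᵒᵖ ⥤ Pointed.{w}} (φ : P ⟶ P') (G : Aᵒᵖ ⥤ C) :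
    homIntegrand P' G ⟶ homIntegrand P G :=
  Functor.whiskerLeft G (Functor.whiskerLeft powerFunctor
    ((Functor.whiskeringLeft A Pointed.{w}ᵒᵖ C).map (NatTrans.rightOp φ)))

/-- The projection of `∏_{P(y)} G(x)` to a factor. -/
def π (P : Aᵒᵖ ⥤ Pointed.{w}) (G : Aᵒᵖ ⥤ C) (x : Aᵒᵖ) (y : A) (p : (P.obj (op y)).X) :
    ((homIntegrand P G).obj x).obj y ⟶ G.obj x :=
  power.π (G.obj x) (P.obj (op y)) p

/-- The morphism into `∏_{P(y)} G(x)` with prescribed components. -/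
def lift {P : Aᵒᵖ ⥤ Pointed.{w}} {G : Aᵒᵖ ⥤ C} {x : Aᵒᵖ} {y : A} {X : C}
    (f : (P.obj (op y)).X → (X ⟶ G.obj x)) : X ⟶ ((homIntegrand P G).obj x).obj y :=
  power.lift f

variable (P P' : Aᵒᵖ ⥤ Pointed.{w}) (G G' : Aᵒᵖ ⥤ C)

theorem π_point (x : Aᵒᵖ) (y : A) : π P G x y (P.obj (op y)).point = 0 := power.π_point _ _

theorem hom_ext {P : Aᵒᵖ ⥤ Pointed.{w}} {G : Aᵒᵖ ⥤ C} {x : Aᵒᵖ} {y : A} {X : C}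
    {f g : X ⟶ ((homIntegrand P G).obj x).obj y}
    (e : ∀ p, f ≫ π P G x y p = g ≫ π P G x y p) : f = g := power.hom_ext e

theorem lift_π {P : Aᵒᵖ ⥤ Pointed.{w}} {G : Aᵒᵖ ⥤ C} {x : Aᵒᵖ} {y : A} {X : C}
    (f : (P.obj (op y)).X → (X ⟶ G.obj x)) (hf : f (P.obj (op y)).point = 0)
    (p : (P.obj (op y)).X) : lift f ≫ π P G x y p = f p := power.lift_π f hf p

theorem map_π {x x' : Aᵒᵖ} (α : x ⟶ x') (y : A) (p : (P.obj (op y)).X) :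
    ((homIntegrand P G).map α).app y ≫ π P G x' y p = π P G x y p ≫ G.map α :=
  power.app_π (G.map α) (P.obj (op y)) p

theorem obj_map_π (x : Aᵒᵖ) {y y' : A} (α : y ⟶ y') (p : (P.obj (op y')).X) :
    ((homIntegrand P G).obj x).map α ≫ π P G x y' p = π P G x y ((P.map α.op).toFun p) :=
  power.map_π (G.obj x) (P.map α.op) p

variable {P P' G G'}

theorem mapRight_π (φ : G ⟶ G') (x : Aᵒᵖ) (y : A) (p : (P.obj (op y)).X) :
    ((mapRight P φ).app x).app y ≫ π P G' x y p = π P G x y p ≫ φ.app x :=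
  power.app_π (φ.app x) (P.obj (op y)) p

theorem mapLeft_π (φ : P ⟶ P') (x : Aᵒᵖ) (y : A) (p : (P.obj (op y)).X) :
    ((mapLeft φ G).app x).app y ≫ π P G x y p = π P' G x y ((φ.app (op y)).toFun p) :=
  power.map_π (G.obj x) (φ.app (op y)) p

end homIntegrand

/-- `Hom^A(P, G)`, the end of `∏_{P(y)} G(x)`. -/
abbrev homEnd (P : Aᵒᵖ ⥤ Pointed.{w}) (G : Aᵒᵖ ⥤ C) : C := end_ (homIntegrand P G)

namespace homEnd

/-- Covariant functoriality of `Hom^A(P, G)` in `G`. -/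
def mapRight (P : Aᵒᵖ ⥤ Pointed.{w}) {G G' : Aᵒᵖ ⥤ C} (φ : G ⟶ G') : homEnd P G ⟶ homEnd P G' :=
  end_.map (homIntegrand.mapRight P φ)

/-- Contravariant functoriality of `Hom^A(P, G)` in `P`. -/
def mapLeft {P P' : Aᵒᵖ ⥤ Pointed.{w}} (φ : P ⟶ P') (G : Aᵒᵖ ⥤ C) : homEnd P' G ⟶ homEnd P G :=
  end_.map (homIntegrand.mapLeft φ G)

/-- The structure morphism `Hom^A(P, G) → G(a)` attached to `p ∈ P(a)`. -/
def π (P : Aᵒᵖ ⥤ Pointed.{w}) (G : Aᵒᵖ ⥤ C) (a : A) (p : (P.obj (op a)).X) :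
    homEnd P G ⟶ G.obj (op a) :=
  end_.π (homIntegrand P G) a ≫ homIntegrand.π P G (op a) a p

theorem π_point (P : Aᵒᵖ ⥤ Pointed.{w}) (G : Aᵒᵖ ⥤ C) (a : A) :
    π P G a (P.obj (op a)).point = 0 := by
  rw [π, homIntegrand.π_point, comp_zero]

theorem condition (P : Aᵒᵖ ⥤ Pointed.{w}) (G : Aᵒᵖ ⥤ C) {a a' : A} (α : a ⟶ a')
    (p : (P.obj (op a')).X) : π P G a' p ≫ G.map α.op = π P G a ((P.map α.op).toFun p) := by
  rw [π, π, ← homIntegrand.obj_map_π, ← Category.assoc, end_.condition, Category.assoc,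
    Category.assoc, homIntegrand.map_π]

theorem hom_ext {P : Aᵒᵖ ⥤ Pointed.{w}} {G : Aᵒᵖ ⥤ C} {X : C} {f g : X ⟶ homEnd P G}
    (e : ∀ a p, f ≫ π P G a p = g ≫ π P G a p) : f = g := by
  refine end_.hom_ext fun a ↦ homIntegrand.hom_ext fun p ↦ ?_
  simpa only [π, ← Category.assoc] using e a p

theorem mapRight_π (P : Aᵒᵖ ⥤ Pointed.{w}) {G G' : Aᵒᵖ ⥤ C} (φ : G ⟶ G') (a : A)
    (p : (P.obj (op a)).X) : mapRight P φ ≫ π P G' a p = π P G a p ≫ φ.app (op a) := by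
  rw [π, π, mapRight, ← Category.assoc, end_.map_π, Category.assoc, homIntegrand.mapRight_π,
    Category.assoc]

theorem mapLeft_π {P P' : Aᵒᵖ ⥤ Pointed.{w}} (φ : P ⟶ P') (G : Aᵒᵖ ⥤ C) (a : A)
    (p : (P.obj (op a)).X) : mapLeft φ G ≫ π P G a p = π P' G a ((φ.app (op a)).toFun p) := by
  rw [π, π, mapLeft, ← Category.assoc, end_.map_π, Category.assoc, homIntegrand.mapLeft_π]

theorem mapLeft_id (P : Aᵒᵖ ⥤ Pointed.{w}) (G : Aᵒᵖ ⥤ C) : mapLeft (𝟙 P) G = 𝟙 (homEnd P G) :=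
  hom_ext fun a p ↦ (mapLeft_π (𝟙 P) G a p).trans (Category.id_comp _).symm

theorem mapLeft_comp {P P' P'' : Aᵒᵖ ⥤ Pointed.{w}} (φ : P ⟶ P') (ψ : P' ⟶ P'') (G : Aᵒᵖ ⥤ C) :
    mapLeft (φ ≫ ψ) G = mapLeft ψ G ≫ mapLeft φ G :=
  hom_ext fun a p ↦ by
    rw [mapLeft_π, Category.assoc, mapLeft_π, mapLeft_π]; rfl

theorem mapRight_id (P : Aᵒᵖ ⥤ Pointed.{w}) (G : Aᵒᵖ ⥤ C) : mapRight P (𝟙 G) = 𝟙 (homEnd P G) :=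
  hom_ext fun a p ↦ (mapRight_π P (𝟙 G) a p).trans
    ((Category.comp_id _).trans (Category.id_comp _).symm)

theorem mapRight_comp (P : Aᵒᵖ ⥤ Pointed.{w}) {G G' G'' : Aᵒᵖ ⥤ C} (φ : G ⟶ G') (ψ : G' ⟶ G'') :
    mapRight P (φ ≫ ψ) = mapRight P φ ≫ mapRight P ψ :=
  hom_ext fun a p ↦ by
    rw [mapRight_π, NatTrans.comp_app, Category.assoc, mapRight_π, ← Category.assoc,
      ← Category.assoc, mapRight_π]

theorem mapLeft_mapRight {P P' : Aᵒᵖ ⥤ Pointed.{w}} (ψ : P ⟶ P') {G G' : Aᵒᵖ ⥤ C} (φ : G ⟶ G') :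
    mapLeft ψ G ≫ mapRight P φ = mapRight P' φ ≫ mapLeft ψ G' :=
  hom_ext fun a p ↦ by
    rw [Category.assoc, mapRight_π, ← Category.assoc, mapLeft_π, Category.assoc, mapLeft_π,
      mapRight_π]

/-- The morphism into `Hom^A(P, G)` with prescribed components. -/
def lift {P : Aᵒᵖ ⥤ Pointed.{w}} {G : Aᵒᵖ ⥤ C} {X : C}
    (f : ∀ a : A, (P.obj (op a)).X → (X ⟶ G.obj (op a))) (h0 : ∀ a, f a (P.obj (op a)).point = 0)
    (hf : ∀ {a a' : A} (α : a ⟶ a') (p : (P.obj (op a')).X),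
      f a' p ≫ G.map α.op = f a ((P.map α.op).toFun p)) : X ⟶ homEnd P G :=
  end_.lift (F := homIntegrand P G) (fun a ↦ homIntegrand.lift (f a)) fun a a' α ↦
    homIntegrand.hom_ext fun p ↦ by
      rw [Category.assoc, Category.assoc, homIntegrand.map_π, homIntegrand.obj_map_π,
        ← Category.assoc, homIntegrand.lift_π _ (h0 a), homIntegrand.lift_π _ (h0 a'), hf]

theorem lift_π {P : Aᵒᵖ ⥤ Pointed.{w}} {G : Aᵒᵖ ⥤ C} {X : C}
    (f : ∀ a : A, (P.obj (op a)).X → (X ⟶ G.obj (op a))) (h0 : ∀ a, f a (P.obj (op a)).point = 0)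
    (hf : ∀ {a a' : A} (α : a ⟶ a') (p : (P.obj (op a')).X),
      f a' p ≫ G.map α.op = f a ((P.map α.op).toFun p)) (a : A) (p : (P.obj (op a)).X) :
    lift f h0 hf ≫ π P G a p = f a p := by
  rw [π, lift, ← Category.assoc, end_.lift_π, homIntegrand.lift_π _ (h0 a)]

end homEnd

end Hom

variable (P : Aᵒᵖ ⥤ B ⥤ Pointed.{w})

section L

variable [HasColimitsOfSize.{w, w} C]

/-- The functor `𝓛 F : A^op → C`, `𝓛 F(a) = F ⊗_B P(a, -)`. -/
def functorLObj (F : Bᵒᵖ ⥤ C) : Aᵒᵖ ⥤ C where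
  obj a := tensor F (P.obj a)
  map α := tensor.mapRight F (P.map α)
  map_id a := by rw [P.map_id, tensor.mapRight_id]
  map_comp α α' := by rw [P.map_comp, tensor.mapRight_comp]

/-- The functor `𝓛 : [B^op, C] → [A^op, C]` of a bimodule `P`, `𝓛 F(a) = F ⊗_B P(a, -)`. -/
def functorL : (Bᵒᵖ ⥤ C) ⥤ (Aᵒᵖ ⥤ C) where
  obj F := functorLObj P F
  map φ :=
    { app := fun a ↦ tensor.mapLeft φ (P.obj a)
      naturality := fun _ _ α ↦ tensor.mapRight_mapLeft φ (P.map α) }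
  map_id F := by
    ext a : 2
    exact tensor.mapLeft_id F (P.obj a)
  map_comp φ ψ := by
    ext a : 2
    exact tensor.mapLeft_comp φ ψ (P.obj a)

namespace functorL

variable (F F' : Bᵒᵖ ⥤ C)

/-- The structure morphism `F(b) → 𝓛 F(a)` attached to `p ∈ P(a, b)`. -/
def ι (a : Aᵒᵖ) (b : B) (p : ((P.obj a).obj b).X) :
    F.obj (op b) ⟶ ((functorL P).obj F).obj a :=
  tensor.ι F (P.obj a) b p

theorem ι_point (a : Aᵒᵖ) (b : B) : ι P F a b ((P.obj a).obj b).point = 0 := tensor.ι_point _ _ _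

theorem condition (a : Aᵒᵖ) {b b' : B} (β : b ⟶ b') (p : ((P.obj a).obj b).X) :
    F.map β.op ≫ ι P F a b p = ι P F a b' (((P.obj a).map β).toFun p) := tensor.condition _ _ β p

theorem ι_map {a a' : Aᵒᵖ} (α : a ⟶ a') (b : B) (p : ((P.obj a).obj b).X) :
    ι P F a b p ≫ ((functorL P).obj F).map α = ι P F a' b (((P.map α).app b).toFun p) :=
  tensor.ι_mapRight _ _ _ _

variable {F F'}

theorem ι_app (φ : F ⟶ F') (a : Aᵒᵖ) (b : B) (p : ((P.obj a).obj b).X) :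
    ι P F a b p ≫ ((functorL P).map φ).app a = φ.app (op b) ≫ ι P F' a b p :=
  tensor.ι_mapLeft _ _ _ _

variable {P}

theorem hom_ext {a : Aᵒᵖ} {X : C} {f g : ((functorL P).obj F).obj a ⟶ X}
    (e : ∀ b p, ι P F a b p ≫ f = ι P F a b p ≫ g) : f = g := tensor.hom_ext e

/-- The morphism out of `𝓛 F(a)` with prescribed components. -/
def descApp {a : Aᵒᵖ} {X : C} (f : ∀ b : B, ((P.obj a).obj b).X → (F.obj (op b) ⟶ X))
    (h0 : ∀ b, f b ((P.obj a).obj b).point = 0)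
    (hb : ∀ ⦃b b' : B⦄ (β : b ⟶ b') (p : ((P.obj a).obj b).X),
      F.map β.op ≫ f b p = f b' (((P.obj a).map β).toFun p)) : ((functorL P).obj F).obj a ⟶ X :=
  tensor.desc f h0 (fun {_ _} β p ↦ hb β p)

theorem ι_descApp {a : Aᵒᵖ} {X : C} (f : ∀ b : B, ((P.obj a).obj b).X → (F.obj (op b) ⟶ X))
    (h0 : ∀ b, f b ((P.obj a).obj b).point = 0)
    (hb : ∀ ⦃b b' : B⦄ (β : b ⟶ b') (p : ((P.obj a).obj b).X),
      F.map β.op ≫ f b p = f b' (((P.obj a).map β).toFun p)) (b : B) (p : ((P.obj a).obj b).X) :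
    ι P F a b p ≫ descApp f h0 hb = f b p :=
  tensor.ι_desc f h0 (fun {_ _} β p ↦ hb β p) b p

/-- The morphism out of `𝓛 F` with prescribed components. -/
def desc {G : Aᵒᵖ ⥤ C} (f : ∀ (a : Aᵒᵖ) (b : B), ((P.obj a).obj b).X → (F.obj (op b) ⟶ G.obj a))
    (h0 : ∀ a b, f a b ((P.obj a).obj b).point = 0)
    (hb : ∀ (a : Aᵒᵖ) ⦃b b' : B⦄ (β : b ⟶ b') (p : ((P.obj a).obj b).X),
      F.map β.op ≫ f a b p = f a b' (((P.obj a).map β).toFun p))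
    (ha : ∀ ⦃a a' : Aᵒᵖ⦄ (α : a ⟶ a') (b : B) (p : ((P.obj a).obj b).X),
      f a b p ≫ G.map α = f a' b (((P.map α).app b).toFun p)) : (functorL P).obj F ⟶ G where
  app a := descApp (f a) (h0 a) (hb a)
  naturality a a' α := hom_ext fun b p ↦ by
    rw [← Category.assoc, ι_map, ι_descApp, ← Category.assoc, ι_descApp, ha]

theorem ι_desc {G : Aᵒᵖ ⥤ C}
    (f : ∀ (a : Aᵒᵖ) (b : B), ((P.obj a).obj b).X → (F.obj (op b) ⟶ G.obj a))
    (h0 : ∀ a b, f a b ((P.obj a).obj b).point = 0)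
    (hb : ∀ (a : Aᵒᵖ) ⦃b b' : B⦄ (β : b ⟶ b') (p : ((P.obj a).obj b).X),
      F.map β.op ≫ f a b p = f a b' (((P.obj a).map β).toFun p))
    (ha : ∀ ⦃a a' : Aᵒᵖ⦄ (α : a ⟶ a') (b : B) (p : ((P.obj a).obj b).X),
      f a b p ≫ G.map α = f a' b (((P.map α).app b).toFun p)) (a : Aᵒᵖ) (b : B)
    (p : ((P.obj a).obj b).X) : ι P F a b p ≫ (desc f h0 hb ha).app a = f a b p :=
  ι_descApp (f a) (h0 a) (hb a) b p

end functorL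

end L

section R

variable [HasLimitsOfSize.{w, w} C]

/-- The functor `𝓡 G : B^op → C`, `𝓡 G(b) = Hom^A(P(-, b), G)`. -/
def functorRObj (G : Aᵒᵖ ⥤ C) : Bᵒᵖ ⥤ C where
  obj b := homEnd (P.flip.obj b.unop) G
  map β := homEnd.mapLeft (P.flip.map β.unop) G
  map_id b := by rw [unop_id, P.flip.map_id, homEnd.mapLeft_id]
  map_comp β β' := by rw [unop_comp, P.flip.map_comp, homEnd.mapLeft_comp]

/-- The functor `𝓡 : [A^op, C] → [B^op, C]` of a bimodule `P`, `𝓡 G(b) = Hom^A(P(-, b), G)`. -/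
def functorR : (Aᵒᵖ ⥤ C) ⥤ (Bᵒᵖ ⥤ C) where
  obj G := functorRObj P G
  map φ :=
    { app := fun b ↦ homEnd.mapRight (P.flip.obj b.unop) φ
      naturality := fun _ _ β ↦ homEnd.mapLeft_mapRight (P.flip.map β.unop) φ }
  map_id G := by
    ext b : 2
    exact homEnd.mapRight_id (P.flip.obj b.unop) G
  map_comp φ ψ := by
    ext b : 2
    exact homEnd.mapRight_comp (P.flip.obj b.unop) φ ψ

namespace functorR

variable (G G' : Aᵒᵖ ⥤ C)

/-- The structure morphism `𝓡 G(b) → G(a)` attached to `p ∈ P(a, b)`. -/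
def π (b : Bᵒᵖ) (a : A) (p : ((P.obj (op a)).obj b.unop).X) :
    ((functorR P).obj G).obj b ⟶ G.obj (op a) :=
  homEnd.π (P.flip.obj b.unop) G a p

theorem π_point (b : Bᵒᵖ) (a : A) : π P G b a ((P.obj (op a)).obj b.unop).point = 0 :=
  homEnd.π_point _ _ _

theorem condition (b : Bᵒᵖ) {a a' : A} (α : a ⟶ a') (p : ((P.obj (op a')).obj b.unop).X) :
    π P G b a' p ≫ G.map α.op = π P G b a (((P.map α.op).app b.unop).toFun p) :=
  homEnd.condition (P.flip.obj b.unop) G α p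

theorem map_π {b b' : Bᵒᵖ} (β : b ⟶ b') (a : A) (p : ((P.obj (op a)).obj b'.unop).X) :
    ((functorR P).obj G).map β ≫ π P G b' a p = π P G b a (((P.obj (op a)).map β.unop).toFun p) :=
  homEnd.mapLeft_π _ _ _ _

variable {G G'}

theorem app_π (φ : G ⟶ G') (b : Bᵒᵖ) (a : A) (p : ((P.obj (op a)).obj b.unop).X) :
    ((functorR P).map φ).app b ≫ π P G' b a p = π P G b a p ≫ φ.app (op a) :=
  homEnd.mapRight_π _ _ _ _

variable {P}

theorem hom_ext {b : Bᵒᵖ} {X : C} {f g : X ⟶ ((functorR P).obj G).obj b}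
    (e : ∀ a p, f ≫ π P G b a p = g ≫ π P G b a p) : f = g := homEnd.hom_ext e

/-- The morphism into `𝓡 G(b)` with prescribed components. -/
def liftApp {b : Bᵒᵖ} {X : C} (f : ∀ a : A, ((P.obj (op a)).obj b.unop).X → (X ⟶ G.obj (op a)))
    (h0 : ∀ a, f a ((P.obj (op a)).obj b.unop).point = 0)
    (ha : ∀ ⦃a a' : A⦄ (α : a ⟶ a') (p : ((P.obj (op a')).obj b.unop).X),
      f a' p ≫ G.map α.op = f a (((P.map α.op).app b.unop).toFun p)) :
    X ⟶ ((functorR P).obj G).obj b :=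
  homEnd.lift (P := P.flip.obj b.unop) f h0 (fun {_ _} α p ↦ ha α p)

theorem liftApp_π {b : Bᵒᵖ} {X : C}
    (f : ∀ a : A, ((P.obj (op a)).obj b.unop).X → (X ⟶ G.obj (op a)))
    (h0 : ∀ a, f a ((P.obj (op a)).obj b.unop).point = 0)
    (ha : ∀ ⦃a a' : A⦄ (α : a ⟶ a') (p : ((P.obj (op a')).obj b.unop).X),
      f a' p ≫ G.map α.op = f a (((P.map α.op).app b.unop).toFun p)) (a : A)
    (p : ((P.obj (op a)).obj b.unop).X) : liftApp f h0 ha ≫ π P G b a p = f a p :=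
  homEnd.lift_π (P := P.flip.obj b.unop) f h0 (fun {_ _} α p ↦ ha α p) a p

/-- The morphism into `𝓡 G` with prescribed components. -/
def lift {F : Bᵒᵖ ⥤ C}
    (f : ∀ (b : Bᵒᵖ) (a : A), ((P.obj (op a)).obj b.unop).X → (F.obj b ⟶ G.obj (op a)))
    (h0 : ∀ b a, f b a ((P.obj (op a)).obj b.unop).point = 0)
    (ha : ∀ (b : Bᵒᵖ) ⦃a a' : A⦄ (α : a ⟶ a') (p : ((P.obj (op a')).obj b.unop).X),
      f b a' p ≫ G.map α.op = f b a (((P.map α.op).app b.unop).toFun p))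
    (hb : ∀ ⦃b b' : Bᵒᵖ⦄ (β : b ⟶ b') (a : A) (p : ((P.obj (op a)).obj b'.unop).X),
      F.map β ≫ f b' a p = f b a (((P.obj (op a)).map β.unop).toFun p)) :
    F ⟶ (functorR P).obj G where
  app b := liftApp (f b) (h0 b) (ha b)
  naturality b b' β := hom_ext fun a p ↦ by
    rw [Category.assoc, Category.assoc, map_π, liftApp_π, liftApp_π, hb]

theorem lift_π {F : Bᵒᵖ ⥤ C}
    (f : ∀ (b : Bᵒᵖ) (a : A), ((P.obj (op a)).obj b.unop).X → (F.obj b ⟶ G.obj (op a)))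
    (h0 : ∀ b a, f b a ((P.obj (op a)).obj b.unop).point = 0)
    (ha : ∀ (b : Bᵒᵖ) ⦃a a' : A⦄ (α : a ⟶ a') (p : ((P.obj (op a')).obj b.unop).X),
      f b a' p ≫ G.map α.op = f b a (((P.map α.op).app b.unop).toFun p))
    (hb : ∀ ⦃b b' : Bᵒᵖ⦄ (β : b ⟶ b') (a : A) (p : ((P.obj (op a)).obj b'.unop).X),
      F.map β ≫ f b' a p = f b a (((P.obj (op a)).map β.unop).toFun p)) (b : Bᵒᵖ) (a : A)
    (p : ((P.obj (op a)).obj b.unop).X) : (lift f h0 ha hb).app b ≫ π P G b a p = f b a p :=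
  liftApp_π (f b) (h0 b) (ha b) a p

end functorR

end R

variable [HasLimitsOfSize.{w, w} C] [HasColimitsOfSize.{w, w} C]

/-- The adjunction bijection: both `𝓛 F → G` and `F → 𝓡 G` amount to families of morphisms
`F(b) → G(a)` indexed by the elements of `P(a, b)`. -/
def homEquivLR (F : Bᵒᵖ ⥤ C) (G : Aᵒᵖ ⥤ C) :
    ((functorL P).obj F ⟶ G) ≃ (F ⟶ (functorR P).obj G) where
  toFun τ := functorR.lift (fun b a p ↦ functorL.ι P F (op a) b.unop p ≫ τ.app (op a))
    (fun b a ↦ by rw [functorL.ι_point, zero_comp])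
    (fun b a a' α p ↦ by
      rw [Category.assoc, ← τ.naturality, ← Category.assoc, functorL.ι_map])
    (fun b b' β a p ↦ by
      rw [← functorL.condition, Category.assoc]; rfl)
  invFun σ := functorL.desc (fun a b p ↦ σ.app (op b) ≫ functorR.π P G (op b) a.unop p)
    (fun a b ↦ by
      exact (congrArg (σ.app (op b) ≫ ·) (functorR.π_point P G (op b) a.unop)).trans comp_zero)
    (fun a b b' β p ↦ by
      rw [← Category.assoc, σ.naturality, Category.assoc]
      exact congrArg (σ.app (op b') ≫ ·) (functorR.map_π P G β.op a.unop p))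
    (fun a a' α b p ↦ by
      rw [Category.assoc]
      exact congrArg (σ.app (op b) ≫ ·) (functorR.condition P G (op b) α.unop p))
  left_inv τ := by
    ext a : 2
    refine functorL.hom_ext fun b p ↦ ?_
    rw [functorL.ι_desc]
    exact functorR.lift_π _ _ _ _ (op b) a.unop p
  right_inv σ := by
    ext b : 2
    refine functorR.hom_ext fun a p ↦ ?_
    rw [functorR.lift_π]
    exact functorL.ι_desc _ _ _ _ (op a) b.unop p

theorem homEquivLR_π {F : Bᵒᵖ ⥤ C} {G : Aᵒᵖ ⥤ C} (τ : (functorL P).obj F ⟶ G) (b : Bᵒᵖ) (a : A)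
    (p : ((P.obj (op a)).obj b.unop).X) :
    (homEquivLR P F G τ).app b ≫ functorR.π P G b a p =
      functorL.ι P F (op a) b.unop p ≫ τ.app (op a) := by
  dsimp only [homEquivLR, Equiv.coe_fn_mk]
  rw [functorR.lift_π]

theorem ι_homEquivLR_symm {F : Bᵒᵖ ⥤ C} {G : Aᵒᵖ ⥤ C} (σ : F ⟶ (functorR P).obj G) (a : Aᵒᵖ)
    (b : B) (p : ((P.obj a).obj b).X) :
    functorL.ι P F a b p ≫ ((homEquivLR P F G).symm σ).app a =
      σ.app (op b) ≫ functorR.π P G (op b) a.unop p := by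
  dsimp only [homEquivLR, Equiv.coe_fn_symm_mk]
  rw [functorL.ι_desc]

/-- The adjunction `𝓛 ⊣ 𝓡` attached to a bimodule. -/
def adjunctionLR : functorL (C := C) P ⊣ functorR P :=
  Adjunction.mkOfHomEquiv
    { homEquiv := homEquivLR P
      homEquiv_naturality_left_symm := fun f g ↦ by
        ext a : 2
        refine functorL.hom_ext fun b p ↦ ?_
        rw [ι_homEquivLR_symm, NatTrans.comp_app, NatTrans.comp_app, ← Category.assoc,
          functorL.ι_app, Category.assoc, Category.assoc, ι_homEquivLR_symm]
      homEquiv_naturality_right := fun f g ↦ by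
        ext b : 2
        refine functorR.hom_ext fun a p ↦ ?_
        rw [homEquivLR_π, NatTrans.comp_app, NatTrans.comp_app, Category.assoc,
          functorR.app_π, ← Category.assoc, ← Category.assoc, homEquivLR_π] }

end

/-! ### Conjugate pairs -/

/-- The data exhibiting `(B, A)` as a conjugate pair of small categories: a factorization
`U = I ∘ A` admitting conjugation (with `A` the given category, identified with a subcategory of
`U`) and an equivalence of `B` with the category `I ∘ A ∘ I^op`. -/
structure ConjugatePair (B A : Type w) [SmallCategory B] [SmallCategory A] where
  U : Type w
  [categoryU : SmallCategory U]
  subI : MorphismProperty U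
  subA : MorphismProperty U
  [multI : subI.IsMultiplicative]
  [multA : subA.IsMultiplicative]
  admits : AdmitsConjugation subI subA
  equivB : B ≌ ThreeFold admits
  equivA : A ≌ WideSubcategory subA

attribute [instance] ConjugatePair.categoryU ConjugatePair.multI ConjugatePair.multA

/-- The regular bimodule `A^op × B → Sets_*` (in curried form) of a conjugate pair `(B, A)`. -/
def ConjugatePair.bimodule {B A : Type w} [SmallCategory B] [SmallCategory A]
    (p : ConjugatePair B A) : Aᵒᵖ ⥤ B ⥤ Pointed.{w} :=
  p.equivA.functor.op ⋙ ThreeFold.regularBimodule p.admits ⋙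
    (Functor.whiskeringLeft B (ThreeFold p.admits) Pointed.{w}).obj p.equivB.functor

/-- An adjoint pair is an equivalence of categories: both functors are equivalences, and the unit
and the counit are isomorphisms. -/
def IsAdjointEquivalence {D : Type u} {D' : Type u₁} [Category.{v} D] [Category.{v₁} D']
    {L : D ⥤ D'} {R : D' ⥤ D} (adj : L ⊣ R) : Prop :=
  L.IsEquivalence ∧ R.IsEquivalence ∧ IsIso adj.unit ∧ IsIso adj.counit

/-! ### The categories `Γ` and `ℰ` -/

/-- The category `Γ`; its objects are the based sets `n_+ = {0, 1, …, n}` with base point `0`. -/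
structure GammaCat where
  n : ℕ

/-- Morphisms of `Γ` are the based maps. -/
instance : SmallCategory GammaCat where
  Hom X Y := {f : Fin (X.n + 1) → Fin (Y.n + 1) // f 0 = 0}
  id _ := ⟨id, rfl⟩
  comp f g := ⟨g.1 ∘ f.1, by rw [Function.comp_apply, f.2, g.2]⟩

/-- The category `ℰ`; its objects are the sets `n = {1, …, n}`. -/
structure EpiCat where
  n : ℕ

/-- Morphisms of `ℰ` are the surjective maps. -/
instance : SmallCategory EpiCat where
  Hom X Y := {f : Fin X.n → Fin Y.n // Function.Surjective f}
  id _ := ⟨id, Function.surjective_id⟩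
  comp f g := ⟨g.1 ∘ f.1, g.2.comp f.2⟩

/-- The regular maps of `Γ`: only the base point is sent to the base point. -/
def GammaCat.regular : MorphismProperty GammaCat := fun _ _ f ↦ ∀ x, f.1 x = 0 → x = 0

instance : GammaCat.regular.IsMultiplicative where
  id_mem _ _ hx := hx
  comp_mem f _ hf hg x hx := hf x (hg (f.1 x) hx)

/-- The subcategory `𝓤` of regular maps of `Γ`. -/
abbrev GammaCat.Reg := WideSubcategory GammaCat.regular

/-- The subcategory `𝓞` of ordered maps: based maps `i` with `i(x) < i(y)` whenever `x < y`. -/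
def GammaCat.ordered : MorphismProperty GammaCat.Reg := fun _ _ f ↦ StrictMono f.hom.1

instance : GammaCat.ordered.IsMultiplicative where
  id_mem _ := strictMono_id
  comp_mem _ _ hf hg _ _ hxy := hg (hf hxy)

/-- The subcategory of regular surjections. -/
def GammaCat.surj : MorphismProperty GammaCat.Reg := fun _ _ f ↦ Function.Surjective f.hom.1

instance : GammaCat.surj.IsMultiplicative where
  id_mem _ := Function.surjective_id
  comp_mem f g hf hg := Function.Surjective.comp (g := g.hom.1) (f := f.hom.1) hg hf

/-- A map `m → n` extended to a based map `m_+ → n_+`. -/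
def addPointFun {m n : ℕ} (f : Fin m → Fin n) : Fin (m + 1) → Fin (n + 1) :=
  Fin.cases 0 fun x ↦ (f x).succ

/-- The category `ℰ` as a subcategory of `Γ`, by adding disjoint base points. -/
def EpiCat.addPoint : EpiCat ⥤ WideSubcategory GammaCat.surj where
  obj X := ⟨⟨⟨X.n⟩⟩⟩
  map f := wideHom (W := GammaCat.surj) (wideHom (W := GammaCat.regular) ⟨addPointFun f.1, rfl⟩ (by
      intro x
      refine Fin.cases (fun _ ↦ rfl) (fun y hy ↦ ?_) x
      exact absurd hy (Fin.succ_ne_zero _))) (by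
    intro y
    refine Fin.cases ⟨0, rfl⟩ (fun z ↦ ?_) y
    obtain ⟨x, hx⟩ := f.2 z
    exact ⟨x.succ, congrArg Fin.succ hx⟩)
  map_id X := by
    apply WideSubcategory.hom_ext
    apply WideSubcategory.hom_ext
    apply Subtype.ext
    funext x
    exact Fin.cases rfl (fun _ ↦ rfl) x
  map_comp f g := by
    apply WideSubcategory.hom_ext
    apply WideSubcategory.hom_ext
    apply Subtype.ext
    funext x
    exact Fin.cases rfl (fun _ ↦ rfl) x

end Conj
end

open Conj

noncomputable section

namespace Conj

/-! ### Calculus of the morphisms `i^*` in `I ∘ A ∘ I^op`. -/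

section

variable {U : Type w} [SmallCategory U] {I A : MorphismProperty U} [I.IsMultiplicative]
  [A.IsMultiplicative]

/-! Let `B = I ∘ A ∘ I^op`. A presheaf `F` on `B` has restrictions along all of `U` and, through the
morphisms `i^*`, extensions along `I`. Morphisms of `I` are monic, so `i^* ∘ i = 1`: extending along
`i` and restricting back is the identity, and restriction followed by extension is an idempotent of
`F(a)`. Pullbacks in `I` give a base change rule relating these operations for different `i`. Since
`a` has only finitely many `I`-subobjects up to isomorphism, finitely many factors `1 - res ≫
extend` combine into one endomorphism `p` of `F(a)` that annihilates proper extensions and proper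
restrictions and is universal on both sides (`exists_crossProj`). It identifies the quotient of
`F(a)` by all proper extensions with the common kernel of all proper restrictions, the top cross
effect.

Every morphism of `B` is some `i^*` followed by a morphism of `U`, and it is singular exactly if `i`
is not invertible. By a co-Yoneda argument `𝓛 F(a)` is therefore the quotient just described
(`extend_toL`, `exists_toL_desc`). On the other side, a morphism of `U` outside `A` has a proper
`I`-part, so a generalized element of `𝓡 G(a)` killed by proper restrictions is determined by its
component at the identity (`eq_of_res_eq_zero`). Extending `G` by zero off `A` splits that component
(`exists_section`). Hence the counit is invertible.

The functor `𝓛` is conservative, by well-founded induction over the `I`-subobjects of `a`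
(`mono_app_of_isIso_map`, `epi_app_of_isIso_map`). The triangle identity then makes the unit
invertible as well. General conjugate pairs follow by transporting `𝓡` along equivalences
(`restrictRIso`).

For `Γ`, a based map amounts to the subset where it is nonzero together with a regular map on that
subset, and a regular map is a surjection followed by an ordered injection. This yields
`GammaCat.admitsConjugation` and the equivalence `GammaCat.ofThreeFold`. -/

theorem AdmitsConjugation.mem_of_isIso (h : AdmitsConjugation I A) {x y : U} {t : x ⟶ y}
    (ht : I t) [IsIso t] : I (inv t) :=
  h.of_comp_I ht (by rw [IsIso.inv_hom_id]; exact I.id_mem _)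

theorem AdmitsConjugation.isIso_wideHom_iff (h : AdmitsConjugation I A) {x y : U} {t : x ⟶ y}
    (ht : I t) : IsIso (wideHom t ht) ↔ IsIso t := by
  constructor
  · intro _
    exact inferInstanceAs (IsIso ((wideSubcategoryInclusion I).map (wideHom t ht)))
  · intro _
    exact ⟨wideHom (inv t) (h.mem_of_isIso ht), WideSubcategory.hom_ext I (IsIso.hom_inv_id t),
      WideSubcategory.hom_ext I (IsIso.inv_hom_id t)⟩

namespace ThreeFold

variable {h : AdmitsConjugation I A}

theorem homMk_eq_of_span {X Y : ThreeFold h} {x y : Rep I A X.obj Y.obj} (t : x.dom ⟶ y.dom)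
    [IsIso t] (e : t ≫ y.i = x.i) (e' : t ≫ y.u = x.u) : homMk h x = homMk h y :=
  homMk_eq_iff.2 (h.rep_equiv_of_span t (inv t) (by simp) (by simp) e e')

/-- Composition is determined by a pullback of the underlying spans. -/
theorem homMk_comp_of_isPullback {X Y Z : ThreeFold h} (x : Rep I A X.obj Y.obj)
    (y : Rep I A Y.obj Z.obj) (z : Rep I A X.obj Z.obj) {p : z.dom ⟶ x.dom} {q : z.dom ⟶ y.dom}
    (sq : IsPullback p q x.u y.i) (e1 : p ≫ x.i = z.i) (e2 : q ≫ y.u = z.u) :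
    homMk h x ≫ homMk h y = homMk h z := by
  obtain ⟨z', p', q', e, sq', e1', e2'⟩ := homMk_comp_span x y
  rw [e]
  refine homMk_eq_of_span (IsPullback.isoIsPullback _ _ sq' sq).hom ?_ ?_
  · rw [← e1, ← e1', IsPullback.isoIsPullback_hom_fst_assoc]
  · rw [← e2, ← e2', IsPullback.isoIsPullback_hom_snd_assoc]

variable (h)

/-- The morphism `i^*` of `I ∘ A ∘ I^op` attached to a morphism `i` of `I`. -/
def star {w a : U} (i : w ⟶ a) (hi : I i) : (⟨a⟩ : ThreeFold h) ⟶ ⟨w⟩ :=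
  homMk h ⟨w, w, i, 𝟙 w, 𝟙 w, hi, A.id_mem w, I.id_mem w⟩

theorem ofHom_id (a : U) : ofHom h (𝟙 a) = 𝟙 _ := (ofU h).map_id a

theorem ofHom_comp {a b c : U} (f : a ⟶ b) (g : b ⟶ c) :
    ofHom h (f ≫ g) = ofHom h f ≫ ofHom h g := (ofU h).map_comp f g

/-- The isomorphism `t` leaves the representative free: `ofHom` involves a chosen factorization of
`f`, while `x` may carry another one. The composition only pulls back along an identity, so the
square with both legs `t` serves. -/
theorem star_comp_ofHom {w a b : U} (i : w ⟶ a) (hi : I i) (x : Rep I A a b) (t : x.dom ⟶ w) [IsIso t]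
    (e : t ≫ i = x.i) (f : w ⟶ b) (e' : t ≫ f = x.u) :
    star h i hi ≫ ofHom h f = homMk h x := by
  obtain ⟨c, α, j, hα, hj, rfl⟩ := h.factors f
  rw [show ofHom h (α ≫ j) = homMk h (Rep.reg α j hα hj) from ofHom_eq h α j hα hj _ rfl]
  refine homMk_comp_of_isPullback (X := ⟨a⟩) (Y := ⟨w⟩) (Z := ⟨b⟩) _ _ _ (p := t) (q := t) ?_ e e'
  change IsPullback t t (𝟙 w ≫ 𝟙 w) (𝟙 w)
  rw [Category.comp_id]
  exact IsPullback.of_vert_isIso ⟨rfl⟩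

theorem homMk_eq_star_comp {X Y : ThreeFold h} (x : Rep I A X.obj Y.obj) :
    homMk h x = (star h x.i x.hi : X ⟶ ⟨x.dom⟩) ≫ (ofHom h x.u : (⟨x.dom⟩ : ThreeFold h) ⟶ Y) :=
  (star_comp_ofHom h x.i x.hi x (𝟙 _) (Category.id_comp _) x.u (Category.id_comp _)).symm

/-- Consequently the action of all morphisms on a presheaf is controlled by restrictions along `U`
and extensions along `I`. -/
theorem exists_eq_star_comp {X Y : ThreeFold h} (f : X ⟶ Y) :
    ∃ (w : U) (i : w ⟶ X.obj) (hi : I i) (g : w ⟶ Y.obj),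
      f = (star h i hi : X ⟶ ⟨w⟩) ≫ (ofHom h g : (⟨w⟩ : ThreeFold h) ⟶ Y) := by
  obtain ⟨x, rfl⟩ := homMk_surj f
  exact ⟨_, _, _, _, homMk_eq_star_comp h x⟩

theorem isRegular_star_comp_iff {w a b : U} (i : w ⟶ a) (hi : I i) (f : w ⟶ b) :
    IsRegular (star h i hi ≫ ofHom h f) ↔ IsIso i := by
  obtain ⟨c, α, j, hα, hj, rfl⟩ := h.factors f
  rw [star_comp_ofHom h i hi ⟨w, c, i, α, j, hi, hα, hj⟩ (𝟙 w) (Category.id_comp _) (α ≫ j)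
    (Category.id_comp (α ≫ j))]
  exact isRegular_homMk_iff (X := ⟨a⟩) (Y := ⟨b⟩) _

/-- Base change: `j^* ∘ i = l ∘ k^*` for a pullback square `k ≫ i = l ≫ j` in `I`. -/
theorem exists_ofHom_comp_star {w v a : U} (i : w ⟶ a) (hi : I i) (j : v ⟶ a) (hj : I j) :
    ∃ (q : U) (k : q ⟶ w) (l : q ⟶ v) (hk : I k) (_ : I l), IsPullback k l i j ∧
      ofHom h i ≫ star h j hj = star h k hk ≫ ofHom h l := by
  obtain ⟨q, k, l, hk, hl, sq⟩ := h.exists_pullback_I i j hi hj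
  refine ⟨q, k, l, hk, hl, h.isPullback_of_wide sq, ?_⟩
  have sq' := h.isPullback_of_wide sq
  rw [star_comp_ofHom h k hk ⟨q, q, k, 𝟙 q, l, hk, A.id_mem q, hl⟩ (𝟙 q) (Category.id_comp _) l rfl,
    show ofHom h i = homMk h (Rep.reg (𝟙 w) i (A.id_mem w) hi) from
      ofHom_eq h _ _ _ hi _ (Category.id_comp _)]
  refine homMk_comp_of_isPullback (X := ⟨w⟩) (Y := ⟨a⟩) (Z := ⟨v⟩) _ _ _ (p := k) (q := l) ?_
    (Category.comp_id _) ?_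
  · rw [show (Rep.reg (𝟙 w) i (A.id_mem w) hi : Rep I A w a).u = i from Category.id_comp _]
    exact sq'
  · change l ≫ 𝟙 v ≫ 𝟙 v = 𝟙 q ≫ l
    simp

/-- Morphisms of `I` are monic in `U`, so the pullback defining the composite is the trivial kernel
pair. -/
theorem ofHom_comp_star_self {w a : U} (i : w ⟶ a) (hi : I i) :
    ofHom h i ≫ star h i hi = 𝟙 _ := by
  have := h.mono_of_I hi
  rw [show ofHom h i = homMk h (Rep.reg (𝟙 w) i (A.id_mem w) hi) from
      ofHom_eq h _ _ _ hi _ (Category.id_comp _)]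
  refine homMk_comp_of_isPullback (X := ⟨w⟩) (Y := ⟨a⟩) (Z := ⟨w⟩) _ _ (Rep.id I A w) (p := 𝟙 w)
    (q := 𝟙 w) ?_ (Category.comp_id _) ?_
  · rw [show (Rep.reg (𝟙 w) i (A.id_mem w) hi : Rep I A w a).u = i from Category.id_comp _]
    exact IsKernelPair.id_of_mono i
  · change 𝟙 w ≫ 𝟙 w ≫ 𝟙 w = 𝟙 w ≫ 𝟙 w
    simp

theorem star_comp_star {q w a : U} (i : w ⟶ a) (hi : I i) (k : q ⟶ w) (hk : I k) :
    star h i hi ≫ star h k hk = star h (k ≫ i) (I.comp_mem _ _ hk hi) := by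
  refine homMk_comp_of_isPullback (X := ⟨a⟩) (Y := ⟨w⟩) (Z := ⟨q⟩) _ _ _ (p := k) (q := 𝟙 q) ?_
    rfl ?_
  · rw [show (⟨w, w, i, 𝟙 w, 𝟙 w, hi, A.id_mem w, I.id_mem w⟩ : Rep I A a w).u = 𝟙 w from
      Category.comp_id _]
    exact IsPullback.of_vert_isIso ⟨by simp⟩
  · change 𝟙 q ≫ 𝟙 q ≫ 𝟙 q = 𝟙 q ≫ 𝟙 q
    simp

end ThreeFold

end

/-! ### Restrictions, extensions and cross effects of presheaves on `I ∘ A ∘ I^op`. -/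

section

variable {U : Type w} [SmallCategory U] {I A : MorphismProperty U} [I.IsMultiplicative]
  [A.IsMultiplicative] {h : AdmitsConjugation I A} {C : Type u} [Category.{v} C]

/-- Restriction of a presheaf along a morphism `f` of `U`. -/
def res (F : (ThreeFold h)ᵒᵖ ⥤ C) {w a : U} (f : w ⟶ a) :
    F.obj (op ⟨a⟩) ⟶ F.obj (op ⟨w⟩) := F.map (ThreeFold.ofHom h f).op

/-- The morphism induced on a presheaf by `i^*`, for a morphism `i` of `I`. -/
def extend (F : (ThreeFold h)ᵒᵖ ⥤ C) {w a : U} (i : w ⟶ a) (hi : I i) :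
    F.obj (op ⟨w⟩) ⟶ F.obj (op ⟨a⟩) := F.map (ThreeFold.star h i hi).op

variable (F F' : (ThreeFold h)ᵒᵖ ⥤ C)

theorem res_id (a : U) : res F (𝟙 a) = 𝟙 _ := by
  rw [res, ThreeFold.ofHom_id, op_id, F.map_id]

theorem res_comp {q w a : U} (f : w ⟶ a) (g : q ⟶ w) : res F f ≫ res F g = res F (g ≫ f) := by
  rw [res, res, res, ThreeFold.ofHom_comp, op_comp, F.map_comp]

theorem extend_comp {q w a : U} (i : w ⟶ a) (hi : I i) (k : q ⟶ w) (hk : I k) :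
    extend F k hk ≫ extend F i hi = extend F (k ≫ i) (I.comp_mem _ _ hk hi) := by
  rw [extend, extend, extend, ← ThreeFold.star_comp_star, op_comp, F.map_comp]

theorem extend_res {w a : U} (i : w ⟶ a) (hi : I i) : extend F i hi ≫ res F i = 𝟙 _ := by
  rw [extend, res, ← F.map_comp, ← op_comp, ThreeFold.ofHom_comp_star_self, op_id, F.map_id]

theorem extend_congr {w a : U} {i j : w ⟶ a} (e : i = j) (hi : I i) (hj : I j) :
    extend F i hi = extend F j hj := by
  subst e; rfl

theorem extend_comp_comm {q w v a : U} {i : w ⟶ a} (hi : I i) {k : q ⟶ w} (hk : I k) {j : v ⟶ a}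
    (hj : I j) {l : q ⟶ v} (hl : I l) (e : k ≫ i = l ≫ j) :
    extend F k hk ≫ extend F i hi = extend F l hl ≫ extend F j hj := by
  rw [extend_comp, extend_comp, extend_congr F e]

/-- Base change read on a presheaf. Of the pullback square only its commutativity is kept, which is
all that the cross effect computations need. -/
theorem exists_extend_comp_res {w v a : U} (i : w ⟶ a) (hi : I i) (j : v ⟶ a) (hj : I j) :
    ∃ (q : U) (k : q ⟶ w) (l : q ⟶ v) (hk : I k) (_ : I l), k ≫ i = l ≫ j ∧
      extend F j hj ≫ res F i = res F l ≫ extend F k hk := by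
  obtain ⟨q, k, l, hk, hl, sq, e⟩ := ThreeFold.exists_ofHom_comp_star h i hi j hj
  refine ⟨q, k, l, hk, hl, sq.w, ?_⟩
  rw [extend, res, ← F.map_comp, ← op_comp, e, op_comp, F.map_comp]
  rfl

variable {F F'}

theorem res_naturality (φ : F ⟶ F') {w a : U} (f : w ⟶ a) :
    res F f ≫ φ.app (op ⟨w⟩) = φ.app (op ⟨a⟩) ≫ res F' f := φ.naturality _

theorem extend_naturality (φ : F ⟶ F') {w a : U} (i : w ⟶ a) (hi : I i) :
    extend F i hi ≫ φ.app (op ⟨a⟩) = φ.app (op ⟨w⟩) ≫ extend F' i hi := φ.naturality _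

variable [Preadditive C]

/-- The endomorphism `p` of `F(a)` annihilates the restrictions to the objects of `S` and the
extensions from them, and it is the universal such endomorphism on both sides. -/
structure IsCrossProj (F : (ThreeFold h)ᵒᵖ ⥤ C) {a : U} (S : Set (Over (⟨a⟩ : WideSubcategory I)))
    (p : F.obj (op ⟨a⟩) ⟶ F.obj (op ⟨a⟩)) : Prop where
  extend_comp : ∀ o ∈ S, extend F o.hom.hom o.hom.property ≫ p = 0
  comp_res : ∀ o ∈ S, p ≫ res F o.hom.hom = 0
  comp_eq : ∀ {X : C} (y : F.obj (op ⟨a⟩) ⟶ X),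
    (∀ o ∈ S, extend F o.hom.hom o.hom.property ≫ y = 0) → p ≫ y = y
  eq_comp : ∀ {X : C} (x : X ⟶ F.obj (op ⟨a⟩)), (∀ o ∈ S, x ≫ res F o.hom.hom = 0) → x ≫ p = x

/-- The old projection is placed between two copies of `1 - res ≫ extend`, so it need not commute
with the new idempotent. The left copy kills extensions from `o`, the right one kills restrictions
to `o`. Base change shows that neither copy spoils what `p` already annihilates. -/
theorem IsCrossProj.insert {a : U} {S : Set (Over (⟨a⟩ : WideSubcategory I))}
    {p : F.obj (op ⟨a⟩) ⟶ F.obj (op ⟨a⟩)} (hp : IsCrossProj F S p)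
    (o : Over (⟨a⟩ : WideSubcategory I)) :
    IsCrossProj F (insert o S)
      ((𝟙 _ - res F o.hom.hom ≫ extend F o.hom.hom o.hom.property) ≫ p ≫
        (𝟙 _ - res F o.hom.hom ≫ extend F o.hom.hom o.hom.property)) := by
  obtain ⟨h1, h2, h3, h4⟩ := hp
  have key := extend_res F o.hom.hom o.hom.property
  constructor
  · rintro o' (rfl | ho')
    · simp only [Preadditive.comp_sub, Preadditive.sub_comp, Category.id_comp, Category.comp_id,
        Category.assoc, reassoc_of% key, sub_self]
    · obtain ⟨q, k, l, hk, hl, e, e'⟩ := exists_extend_comp_res F o.hom.hom o.hom.property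
        o'.hom.hom o'.hom.property
      -- The pullback of `o` and `o'` lies over `o'`, so extending from it to `a` passes through the
      -- extension from `o'`, which `p` annihilates.
      have e2 : extend F k hk ≫ extend F o.hom.hom o.hom.property ≫ p = 0 := by
        have e0 := extend_comp_comm F o.hom.property hk o'.hom.property hl e
        rw [reassoc_of% e0, h1 o' ho', comp_zero]
      have e3 : extend F o'.hom.hom o'.hom.property ≫
          (𝟙 _ - res F o.hom.hom ≫ extend F o.hom.hom o.hom.property) ≫ p = 0 := by
        simp only [Preadditive.comp_sub, Preadditive.sub_comp, Category.id_comp,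
          Category.assoc, h1 o' ho', reassoc_of% e', e2, comp_zero, sub_zero]
      rw [reassoc_of% e3, zero_comp]
  · rintro o' (rfl | ho')
    · simp only [Preadditive.comp_sub, Preadditive.sub_comp, Category.id_comp,
        Category.assoc, key, Category.comp_id, sub_self]
    · obtain ⟨q, k, l, hk, hl, e, e'⟩ := exists_extend_comp_res F o'.hom.hom o'.hom.property
        o.hom.hom o.hom.property
      -- Dually, restricting to the pullback passes through the restriction to `o'`.
      have e2 : p ≫ res F o.hom.hom ≫ res F l = 0 := by
        rw [res_comp, ← e, ← res_comp, reassoc_of% (h2 o' ho'), zero_comp]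
      have e3 : p ≫ (𝟙 _ - res F o.hom.hom ≫ extend F o.hom.hom o.hom.property) ≫
          res F o'.hom.hom = 0 := by
        simp only [Preadditive.comp_sub, Preadditive.sub_comp, Category.id_comp,
          Category.assoc, h2 o' ho', e', reassoc_of% e2, zero_comp, sub_zero]
      rw [Category.assoc, Category.assoc, e3, comp_zero]
  · intro X y hy
    have e1 : extend F o.hom.hom o.hom.property ≫ y = 0 := hy o (Or.inl rfl)
    have e2 := h3 y fun o' ho' ↦ hy o' (Or.inr ho')
    simp only [Preadditive.comp_sub, Preadditive.sub_comp, Category.id_comp,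
        Category.assoc, e1, e2, comp_zero, sub_zero]
  · intro X x hx
    have e1 : x ≫ res F o.hom.hom = 0 := hx o (Or.inl rfl)
    have e2 := h4 x fun o' ho' ↦ hx o' (Or.inr ho')
    simp only [Preadditive.comp_sub, Category.comp_id, Preadditive.sub_comp, Category.id_comp,
        Category.assoc, reassoc_of% e1, e2, reassoc_of% e2, zero_comp, sub_zero]

theorem exists_isCrossProj_of_finite {a : U} {S : Set (Over (⟨a⟩ : WideSubcategory I))}
    (hS : S.Finite) (F : (ThreeFold h)ᵒᵖ ⥤ C) : ∃ p, IsCrossProj F S p := by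
  induction S, hS using Set.Finite.induction_on with
  | empty =>
    exact ⟨𝟙 _, by simp, by simp, fun y _ ↦ Category.id_comp y, fun x _ ↦ Category.comp_id x⟩
  | insert _ _ ih =>
    obtain ⟨p, hp⟩ := ih
    exact ⟨_, hp.insert _⟩

/-- The projection of `F(a)` to its top cross effect. -/
theorem exists_crossProj (F : (ThreeFold h)ᵒᵖ ⥤ C) (a : U) :
    ∃ p : F.obj (op ⟨a⟩) ⟶ F.obj (op ⟨a⟩),
      (∀ {w : U} (i : w ⟶ a) (hi : I i), ¬ IsIso i → extend F i hi ≫ p = 0) ∧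
      (∀ {w : U} (i : w ⟶ a), I i → ¬ IsIso i → p ≫ res F i = 0) ∧
      (∀ {X : C} (y : F.obj (op ⟨a⟩) ⟶ X),
        (∀ {w : U} (i : w ⟶ a) (hi : I i), ¬ IsIso i → extend F i hi ≫ y = 0) → p ≫ y = y) ∧
      (∀ {X : C} (x : X ⟶ F.obj (op ⟨a⟩)),
        (∀ {w : U} (i : w ⟶ a), I i → ¬ IsIso i → x ≫ res F i = 0) → x ≫ p = x) := by
  have := h.indexing.finite_skeleton ⟨a⟩
  -- Skeletal representatives of the proper subobjects suffice. They are finite in number, and every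
  -- proper `i` factors through one of them by an isomorphism of `I`, as `fac` records.
  obtain ⟨p, h1, h2, h3, h4⟩ := exists_isCrossProj_of_finite
    (S := {o | o ∈ Set.range (fromSkeleton (Over (⟨a⟩ : WideSubcategory I))).obj ∧
      ¬ IsIso o.hom.hom}) ((Set.finite_range _).subset fun _ ho ↦ ho.1) F
  have fac : ∀ {w : U} (i : w ⟶ a) (_ : I i), ¬ IsIso i →
      ∃ (o : Over (⟨a⟩ : WideSubcategory I)) (t : w ⟶ o.left.obj) (_ : I t),
      (o ∈ Set.range (fromSkeleton (Over (⟨a⟩ : WideSubcategory I))).obj ∧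
      ¬ IsIso o.hom.hom) ∧ i = t ≫ o.hom.hom := by
    intro w i hi ni
    let o' := Over.mk (wideHom i hi)
    let o := (fromSkeleton (Over (⟨a⟩ : WideSubcategory I))).obj (toSkeleton o')
    let e : o' ≅ o := (fromSkeletonToSkeletonIso o').symm
    have e1 : e.hom.left.hom ≫ o.hom.hom = i :=
      congrArg InducedWideCategory.Hom.hom (Over.w e.hom)
    have : IsIso e.hom.left.hom := inferInstanceAs
      (IsIso ((Over.forget _ ⋙ wideSubcategoryInclusion I).map e.hom))
    refine ⟨o, e.hom.left.hom, e.hom.left.property, ⟨⟨_, rfl⟩, fun hn ↦ ni ?_⟩, e1.symm⟩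
    rw [← e1]
    infer_instance
  refine ⟨p, fun {w} i hi ni ↦ ?_, fun {w} i hi ni ↦ ?_, fun y hy ↦ h3 y fun o ho ↦ hy _ _ ho.2,
    fun x hx ↦ h4 x fun o ho ↦ hx _ o.hom.property ho.2⟩
  · obtain ⟨o, t, ht, ho, e⟩ := fac i hi ni
    rw [extend_congr F e hi (I.comp_mem _ _ ht o.hom.property),
      ← extend_comp F o.hom.hom o.hom.property t ht, Category.assoc, h1 o ho, comp_zero]
  · obtain ⟨o, t, ht, ho, rfl⟩ := fac i hi ni
    rw [← res_comp, reassoc_of% (h2 o ho), zero_comp]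

/-- The relation of being a proper subobject is well-founded on the slice categories of `I`. -/
theorem wellFounded_over (h : AdmitsConjugation I A) (a : WideSubcategory I) :
    WellFounded fun k l : Over a ↦ ∃ t : k ⟶ l, ¬ IsIso t := by
  have := h.indexing.finite_skeleton a
  have mono : ∀ {k l : Over a} (t : k ⟶ l), Mono t := fun t ↦ by
    have := h.mono_wide t.left
    exact (Over.forget a).mono_of_mono_map ‹_›
  have ei : ∀ {k : Over a} (t : k ⟶ k), IsIso t := fun t ↦ by
    have := h.indexing.ei t.left
    have : IsIso ((Over.forget a).map t) := this
    exact isIso_of_reflects_iso t (Over.forget a)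
  let r : Skeleton (Over a) → Skeleton (Over a) → Prop := fun k l ↦
    ∃ t : (fromSkeleton (Over a)).obj k ⟶ (fromSkeleton (Over a)).obj l, ¬ IsIso t
  have : Std.Irrefl r := ⟨fun k ⟨t, ht⟩ ↦ ht (ei t)⟩
  -- If `t ≫ s` were invertible, `t` would have a retraction `s ≫ inv (t ≫ s)`. The composite of
  -- that retraction with `t` is idempotent and monic, hence the identity, and `t` would be
  -- invertible.
  have : IsTrans _ r := ⟨fun k l m ⟨t, ht⟩ ⟨s, _⟩ ↦ ⟨t ≫ s, fun _ ↦ ht (by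
    have := mono t
    have := mono (s ≫ inv (t ≫ s) ≫ t)
    have e : t ≫ s ≫ inv (t ≫ s) = 𝟙 _ := by rw [← Category.assoc, IsIso.hom_inv_id]
    exact ⟨s ≫ inv (t ≫ s), e, by
      have := ei (s ≫ inv (t ≫ s) ≫ t)
      rw [← cancel_mono (s ≫ inv (t ≫ s) ≫ t)]
      simp [reassoc_of% e]⟩)⟩⟩
  have wf : WellFounded r := Finite.wellFounded_of_trans_of_irrefl r
  refine Subrelation.wf (r := InvImage r toSkeleton) ?_ (InvImage.wf _ wf)
  rintro k l ⟨t, ht⟩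
  refine ⟨(fromSkeletonToSkeletonIso k).hom ≫ t ≫ (fromSkeletonToSkeletonIso l).inv, fun hn ↦ ht ?_⟩
  have e : t = (fromSkeletonToSkeletonIso k).inv ≫ ((fromSkeletonToSkeletonIso k).hom ≫ t ≫ (fromSkeletonToSkeletonIso l).inv) ≫
    (fromSkeletonToSkeletonIso l).hom := by simp
  rw [e]
  infer_instance

end

/-! ### Generators of `𝓛 F(a)` and components of `𝓡 G(b)` for the regular bimodule. -/

section

variable {U : Type w} [SmallCategory U] {I A : MorphismProperty U} [I.IsMultiplicative]
  [A.IsMultiplicative]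

/-- If `α ≫ j` lies in `A`, then it and `α` give two factorizations of the same morphism, with
`I`-parts the identity and `j`. Their uniqueness provides an invertible `t` with `t ≫ j = 𝟙`. -/
theorem AdmitsConjugation.mem_A_comp_iff (h : AdmitsConjugation I A) {x y z : U} {α : x ⟶ y}
    {j : y ⟶ z} (hα : A α) (hj : I j) : A (α ≫ j) ↔ IsIso j := by
  constructor
  · intro hA
    obtain ⟨t, -, h2, -, s, -, h3, h4⟩ := h.lifts α j (α ≫ j) (𝟙 z) hα hA hj (I.id_mem z)
      (Category.comp_id _).symm
    have e : s = j := by rw [← Category.comp_id s, ← h2, reassoc_of% h4]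
    exact ⟨t, e ▸ h4, h2⟩
  · intro _
    exact A.comp_mem _ _ hα (h.iso_le j ⟨hj, inv j, h.mem_of_isIso hj, by simp, by simp⟩).1

/-- Composing with `α` changes only the `A`-part of `g`. Both conditions say that its `I`-part is
invertible. -/
theorem AdmitsConjugation.mem_A_comp_left_iff (h : AdmitsConjugation I A) {x y z : U} {α : x ⟶ y}
    {g : y ⟶ z} (hα : A α) : A (α ≫ g) ↔ A g := by
  obtain ⟨m, β, j, hβ, hj, rfl⟩ := h.factors g
  rw [← Category.assoc, h.mem_A_comp_iff (A.comp_mem _ _ hα hβ) hj, h.mem_A_comp_iff hβ hj]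

namespace ThreeFold

/-- Makes the choice in `mapOrZero` immaterial. -/
theorem ofHom_injective (h : AdmitsConjugation I A) {a b : U} {f g : a ⟶ b}
    (e : ofHom h f = ofHom h g) : f = g := by
  obtain ⟨c, α, j, hα, hj, rfl⟩ := h.factors f
  rw [ofHom_eq h α j hα hj _ rfl, homMk_eq_ofHom h (X := ⟨a⟩) (Y := ⟨b⟩)] at e
  exact e.2.trans (Category.id_comp g)

theorem isRegular_ofHom {h : AdmitsConjugation I A} {a b : U} (f : a ⟶ b) :
    IsRegular (ofHom h f) := ⟨f, rfl⟩

end ThreeFold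

open ThreeFold

variable {h : AdmitsConjugation I A} {C : Type u} [Category.{v} C] [HasZeroMorphisms C]

section L

variable [HasColimitsOfSize.{w, w} C] (F : (ThreeFold h)ᵒᵖ ⥤ C) (a : WideSubcategory A)

/-- The projection `F(a) → 𝓛 F(a)`. -/
def toL : F.obj (op ⟨a.obj⟩) ⟶ ((functorL (regularBimodule h)).obj F).obj (op a) :=
  functorL.ι (regularBimodule h) F (op a) ⟨a.obj⟩ (toPlus (𝟙 _))

theorem map_toL {b : ThreeFold h} (f : ⟨a.obj⟩ ⟶ b) :
    F.map f.op ≫ toL F a = functorL.ι (regularBimodule h) F (op a) b (toPlus f) := by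
  refine (functorL.condition _ F (op a) f _).trans
    (congrArg (functorL.ι (regularBimodule h) F (op a) b) ?_)
  refine (toPlus_bind (fun g ↦ g ≫ f) (fun _ ↦ IsRegular.of_comp_right _ _) (𝟙 _)).trans ?_
  rw [Category.id_comp]

/-- Every element of `U(a, b)_+` other than the base point is obtained from the identity of `a` by
the action of `B`, so the summand at the identity generates the coend. -/
instance : Epi (toL F a) where
  left_cancellation {X} x y e := by
    refine functorL.hom_ext fun b p ↦ ?_
    cases p with
    | none =>
      have := functorL.ι_point (regularBimodule h) F (op a) b
      exact (congrArg (· ≫ x) this).trans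
        (zero_comp.trans (zero_comp.symm.trans (congrArg (· ≫ y) this).symm))
    | some f =>
      rw [← toPlus_val f, ← map_toL, Category.assoc, e, Category.assoc]

theorem extend_toL {w : U} (i : w ⟶ a.obj) (hi : I i) (ni : ¬ IsIso i) :
    extend F i hi ≫ toL F a = 0 := by
  refine (map_toL F a (star h i hi)).trans ?_
  have : ¬ IsRegular (star h i hi) := by
    rwa [← isRegular_star_comp_iff h i hi (𝟙 w), ofHom_id, Category.comp_id] at ni
  rw [toPlus, dif_neg this]
  exact functorL.ι_point (regularBimodule h) F (op a) _

variable {F a}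

/-- Together with `extend_toL` and the epimorphism property, this makes `toL` a joint cokernel of
the proper extensions. A singular morphism begins with some `i^*` for `i` not invertible, so `x`
kills its action, and the zero assigned to the base point is consistent. -/
theorem exists_toL_desc {X : C} (x : F.obj (op ⟨a.obj⟩) ⟶ X)
    (hx : ∀ {w : U} (i : w ⟶ a.obj) (hi : I i), ¬ IsIso i → extend F i hi ≫ x = 0) :
    ∃ y : ((functorL (regularBimodule h)).obj F).obj (op a) ⟶ X, toL F a ≫ y = x := by
  have hs : ∀ {b : ThreeFold h} (f : ⟨a.obj⟩ ⟶ b), ¬ ThreeFold.IsRegular f → F.map f.op ≫ x = 0 := by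
    intro b f hf
    obtain ⟨w, i, hi, g, rfl⟩ := exists_eq_star_comp h f
    rw [isRegular_star_comp_iff] at hf
    rw [op_comp, F.map_comp, Category.assoc]
    exact (congrArg _ (hx i hi hf)).trans comp_zero
  let f (b : ThreeFold h) (p : Option {f : (⟨a.obj⟩ : ThreeFold h) ⟶ b // ThreeFold.IsRegular f}) :
      F.obj (op b) ⟶ X := p.elim 0 fun f ↦ F.map f.1.op ≫ x
  have hf : ∀ {b} (g : (⟨a.obj⟩ : ThreeFold h) ⟶ b), f b (toPlus g) = F.map g.op ≫ x := by
    intro b g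
    by_cases hg : IsRegular g
    · rw [toPlus, dif_pos hg]; rfl
    · rw [toPlus, dif_neg hg, hs g hg]; rfl
  refine ⟨functorL.descApp f (fun _ ↦ rfl) ?_, (functorL.ι_descApp _ _ _ _ _).trans ?_⟩
  · rintro b b' β (_ | p)
    · exact comp_zero
    · refine Eq.trans ?_ (hf (p.1 ≫ β)).symm
      rw [op_comp, F.map_comp, Category.assoc]
      rfl
  · rw [hf, op_id, F.map_id, Category.id_comp]

theorem toL_naturality {F' : (ThreeFold h)ᵒᵖ ⥤ C} (φ : F ⟶ F') (a : WideSubcategory A) :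
    toL F a ≫ ((functorL (regularBimodule h)).map φ).app (op a) = φ.app _ ≫ toL F' a :=
  functorL.ι_app (P := regularBimodule h) φ _ _ _

end L

section R

variable (G : (WideSubcategory A)ᵒᵖ ⥤ C)

open Classical in
/-- The morphism `G(a) → G(a')` attached to `f : a' → a`: it is `G(f)` if `f` is a morphism of `A`
and zero otherwise. -/
def mapOrZero {a a' : WideSubcategory A} (f : (⟨a'.obj⟩ : ThreeFold h) ⟶ ⟨a.obj⟩) :
    G.obj (op a) ⟶ G.obj (op a') :=
  if hf : ∃ α : a' ⟶ a, f = ofHom h α.hom then G.map hf.choose.op else 0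

theorem mapOrZero_ofHom {a a' : WideSubcategory A} (α : a' ⟶ a) :
    mapOrZero G (ofHom h α.hom) = G.map α.op := by
  have hf : ∃ β : a' ⟶ a, ofHom h α.hom = ofHom h β.hom := ⟨α, rfl⟩
  rw [mapOrZero, dif_pos hf, ← (WideSubcategory.hom_ext A (ofHom_injective h hf.choose_spec) :
    α = hf.choose)]

theorem mapOrZero_ofHom_of_not {a a' : WideSubcategory A} (g : a'.obj ⟶ a.obj) (hg : ¬ A g) :
    mapOrZero G (ofHom h g) = 0 := by
  rw [mapOrZero, dif_neg]
  rintro ⟨α, hα⟩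
  rw [ofHom_injective h hα] at hg
  exact hg α.property

theorem mapOrZero_of_not_isRegular {a a' : WideSubcategory A}
    (f : (⟨a'.obj⟩ : ThreeFold h) ⟶ ⟨a.obj⟩) (hf : ¬ IsRegular f) : mapOrZero G f = 0 := by
  rw [mapOrZero, dif_neg]
  rintro ⟨α, rfl⟩
  exact hf (isRegular_ofHom _)

/-- The zero values are consistent because `α` cannot turn a singular morphism into a regular one,
nor a morphism of `U` outside `A` into one of `A`. -/
theorem mapOrZero_map {a a' a'' : WideSubcategory A} (α : a'' ⟶ a')
    (f : (⟨a'.obj⟩ : ThreeFold h) ⟶ ⟨a.obj⟩) :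
    mapOrZero G f ≫ G.map α.op = mapOrZero G (ofHom h α.hom ≫ f) := by
  by_cases hf : IsRegular f
  · obtain ⟨g, rfl⟩ := hf
    change a'.obj ⟶ a.obj at g
    change mapOrZero G (ofHom h g) ≫ _ = mapOrZero G (ofHom h α.hom ≫ ofHom h g)
    rw [← ofHom_comp]
    by_cases hg : A g
    · refine (congrArg (· ≫ G.map α.op) (mapOrZero_ofHom G (wideHom g hg))).trans ?_
      rw [← G.map_comp, ← op_comp, ← mapOrZero_ofHom (h := h)]
      rfl
    · rw [mapOrZero_ofHom_of_not G g hg, mapOrZero_ofHom_of_not, zero_comp]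
      rwa [h.mem_A_comp_left_iff α.property]
  · rw [mapOrZero_of_not_isRegular G f hf, mapOrZero_of_not_isRegular, zero_comp]
    exact fun hr ↦ hf (IsRegular.of_comp_left (X := ⟨a''.obj⟩) (Y := ⟨a'.obj⟩) α.hom α.property _ hr)

variable [HasLimitsOfSize.{w, w} C]

/-- The projection of `𝓡 G(b)` to `G(a)` attached to a morphism `a → b`. -/
def projR (b : ThreeFold h) (a : WideSubcategory A) (f : ⟨a.obj⟩ ⟶ b) :
    ((functorR (regularBimodule h)).obj G).obj (op b) ⟶ G.obj (op a) :=
  functorR.π (regularBimodule h) G (op b) a (toPlus f)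

variable {G} in
-- The component at the base point is zero, so only the regular morphisms, those coming from `U`,
-- have to be tested.
theorem projR_hom_ext {b : ThreeFold h} {X : C}
    {x y : X ⟶ ((functorR (regularBimodule h)).obj G).obj (op b)}
    (e : ∀ (a : WideSubcategory A) (g : a.obj ⟶ b.obj),
      x ≫ projR G b a (ofHom h g) = y ≫ projR G b a (ofHom h g)) : x = y := by
  refine functorR.hom_ext fun a p ↦ ?_
  cases p with
  | none =>
    have := functorR.π_point (regularBimodule h) G (op b) a
    exact (congrArg (x ≫ ·) this).trans
        (comp_zero.trans (comp_zero.symm.trans (congrArg (y ≫ ·) this).symm))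
  | some f =>
    obtain ⟨g, hg⟩ := f.2
    rw [← toPlus_val f, hg]
    exact e a g

theorem map_projR {b b' : ThreeFold h} (β : b' ⟶ b) (a : WideSubcategory A) (f : ⟨a.obj⟩ ⟶ b') :
    ((functorR (regularBimodule h)).obj G).map β.op ≫ projR G b' a f = projR G b a (f ≫ β) :=
  (functorR.map_π _ G β.op a _).trans (congrArg (functorR.π (regularBimodule h) G (op b) a)
    (toPlus_bind (fun g ↦ g ≫ β) (fun _ ↦ IsRegular.of_comp_right _ _) f))

theorem projR_map (b : ThreeFold h) {a a' : WideSubcategory A} (α : a' ⟶ a) (f : ⟨a.obj⟩ ⟶ b) :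
    projR G b a f ≫ G.map α.op = projR G b a' (ofHom h α.hom ≫ f) :=
  (functorR.condition _ G (op b) α _).trans (congrArg (functorR.π (regularBimodule h) G (op b) a')
    (toPlus_bind (fun g ↦ ofHom h α.hom ≫ g)
      (fun _ ↦ IsRegular.of_comp_left (X := ⟨a'.obj⟩) (Y := ⟨a.obj⟩) α.hom α.property _) f))

/-- The extension of `G` by zero is a compatible family by `mapOrZero_map`. Its component at the
identity is the identity, so `s` splits the projection of `𝓡 G(a)` to `G(a)`. -/
theorem exists_section (a : WideSubcategory A) :
    ∃ s : G.obj (op a) ⟶ ((functorR (regularBimodule h)).obj G).obj (op ⟨a.obj⟩),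
      ∀ (a' : WideSubcategory A) (f : (⟨a'.obj⟩ : ThreeFold h) ⟶ ⟨a.obj⟩),
        s ≫ projR G ⟨a.obj⟩ a' f = mapOrZero G f := by
  let f (a' : WideSubcategory A)
    (p : Option {f : (⟨a'.obj⟩ : ThreeFold h) ⟶ ⟨a.obj⟩ // ThreeFold.IsRegular f}) :
      G.obj (op a) ⟶ G.obj (op a') := p.elim 0 fun f ↦ mapOrZero G f.1
  have hf : ∀ {a'} (g : (⟨a'.obj⟩ : ThreeFold h) ⟶ ⟨a.obj⟩), f a' (toPlus g) = mapOrZero G g := by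
    intro a' g
    by_cases hg : IsRegular g
    · rw [toPlus, dif_pos hg]; rfl
    · rw [toPlus, dif_neg hg, mapOrZero_of_not_isRegular G g hg]; rfl
  refine ⟨functorR.liftApp f (fun _ ↦ rfl) ?_,
    fun a' g ↦ (functorR.liftApp_π _ _ _ _ _).trans (hf g)⟩
  rintro a' a'' α (_ | p)
  · exact zero_comp
  · exact (mapOrZero_map G α p.1).trans (hf _).symm

/-- A generalized element of `𝓡 G(a)` annihilated by all proper restrictions is determined by its
component at the identity. -/
theorem eq_of_res_eq_zero {a : WideSubcategory A}
    {s : G.obj (op a) ⟶ ((functorR (regularBimodule h)).obj G).obj (op ⟨a.obj⟩)}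
    (hs : ∀ (a' : WideSubcategory A) (f : (⟨a'.obj⟩ : ThreeFold h) ⟶ ⟨a.obj⟩),
      s ≫ projR G ⟨a.obj⟩ a' f = mapOrZero G f) {X : C}
    (x : X ⟶ ((functorR (regularBimodule h)).obj G).obj (op ⟨a.obj⟩))
    (hx : ∀ {w : U} (i : w ⟶ a.obj), I i → ¬ IsIso i →
      x ≫ res ((functorR (regularBimodule h)).obj G) i = 0) :
    x ≫ projR G ⟨a.obj⟩ a (𝟙 _) ≫ s = x := by
  refine projR_hom_ext fun a' g ↦ ?_
  change a'.obj ⟶ a.obj at g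
  rw [Category.assoc, Category.assoc, hs]
  by_cases hg : A g
  · refine (congrArg (fun y ↦ x ≫ projR G ⟨a.obj⟩ a (𝟙 _) ≫ y)
      (mapOrZero_ofHom G (wideHom g hg))).trans ?_
    rw [projR_map, Category.comp_id]
    rfl
  · rw [mapOrZero_ofHom_of_not G g hg, comp_zero, comp_zero]
    -- The `I`-part `j` of a morphism outside `A` is not invertible, and the component of `x` at `g`
    -- is a component of its restriction along `j`.
    obtain ⟨m, α, j, hα, hj, rfl⟩ := h.factors g
    rw [h.mem_A_comp_iff hα hj] at hg
    have := congrArg (· ≫ projR G ⟨m⟩ a' (ofHom h α)) (hx j hj hg)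
    rw [zero_comp, Category.assoc, res, map_projR] at this
    rw [ofHom_comp, this]

end R

end

/-! ### The counit, conservativity of `𝓛`, and the equivalence for the regular bimodule. -/

section

open ThreeFold

variable {U : Type w} [SmallCategory U] {I A : MorphismProperty U} [I.IsMultiplicative]
  [A.IsMultiplicative] {h : AdmitsConjugation I A} {C : Type u} [Category.{v} C]

section

variable [HasZeroMorphisms C] [HasLimitsOfSize.{w, w} C] [HasColimitsOfSize.{w, w} C]

theorem toL_counit (G : (WideSubcategory A)ᵒᵖ ⥤ C) (a : WideSubcategory A) :
    toL ((functorR (regularBimodule h)).obj G) a ≫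
      ((adjunctionLR (regularBimodule h)).counit.app G).app (op a) = projR G ⟨a.obj⟩ a (𝟙 _) := by
  have := ι_homEquivLR_symm (regularBimodule h) (𝟙 ((functorR (regularBimodule h)).obj G)) (op a)
    ⟨a.obj⟩ (toPlus (𝟙 _))
  rw [adjunctionLR, Adjunction.mkOfHomEquiv_counit_app]
  exact this.trans (Category.id_comp _)

end

section

variable [Preadditive C] [HasLimitsOfSize.{w, w} C] [HasColimitsOfSize.{w, w} C]

/-- The inverse is `s ≫ toL`. On `G(a)` this is the splitting by `s`. On `𝓛 𝓡 G(a)` it follows from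
`p ≫ toL = toL` and from the fact that `p`, being killed by proper restrictions, is recovered from
its identity component by `s`. -/
instance isIso_counit_app_app (G : (WideSubcategory A)ᵒᵖ ⥤ C) (a : WideSubcategory A) :
    IsIso (((adjunctionLR (regularBimodule h)).counit.app G).app (op a)) := by
  obtain ⟨s, hs⟩ := exists_section (h := h) G a
  obtain ⟨p, -, h2, h3, -⟩ := exists_crossProj ((functorR (regularBimodule h)).obj G) a.obj
  have e1 : s ≫ projR G ⟨a.obj⟩ a (𝟙 _) = 𝟙 _ := by
    rw [hs, ← ofHom_id]
    exact (mapOrZero_ofHom G (𝟙 a)).trans (G.map_id _)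
  have e2 := eq_of_res_eq_zero G hs p h2
  have e3 := h3 (toL _ a) (extend_toL _ a)
  refine ⟨s ≫ toL _ a, ?_, ?_⟩
  · rw [← cancel_epi (toL _ a), ← Category.assoc, toL_counit]
    refine Eq.trans ?_ (e3.trans (Category.comp_id _).symm)
    rw [← e2, Category.assoc, Category.assoc, ← toL_counit, Category.assoc, reassoc_of% e3]
  · rw [Category.assoc, toL_counit]
    exact e1

instance isIso_counit : IsIso (adjunctionLR (C := C) (regularBimodule h)).counit := by
  have (G : (WideSubcategory A)ᵒᵖ ⥤ C) :
      IsIso ((adjunctionLR (regularBimodule h)).counit.app G) := by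
    have (a : (WideSubcategory A)ᵒᵖ) :
      IsIso (((adjunctionLR (regularBimodule h)).counit.app G).app a) :=
      isIso_counit_app_app G a.unop
    exact NatIso.isIso_of_isIso_app _
  exact NatIso.isIso_of_isIso_app _

end

section

variable [Preadditive C] [HasColimitsOfSize.{w, w} C] {F F' : (ThreeFold h)ᵒᵖ ⥤ C} (φ : F ⟶ F')

/-- A claim at `a` itself is proved for all `I`-subobjects `i` of `a` at once. The predecessors of
`i` are the composites `j ≫ i` with `j` not invertible. -/
theorem induction_over (h : AdmitsConjugation I A) {a : U} {motive : ∀ {w : U} (i : w ⟶ a), I i → Prop}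
    (step : ∀ {w : U} (i : w ⟶ a) (hi : I i), (∀ {v : U} (j : v ⟶ w) (hj : I j), ¬ IsIso j →
      motive (j ≫ i) (I.comp_mem _ _ hj hi)) → motive i hi) : motive (𝟙 a) (I.id_mem a) := by
  suffices ∀ o : Over (⟨a⟩ : WideSubcategory I), motive o.hom.hom o.hom.property from
    this (Over.mk (𝟙 _))
  intro o
  induction o using (wellFounded_over h ⟨a⟩).induction with
  | _ o ih =>
    refine step _ _ fun {v} j hj nj ↦
      ih (Over.mk (wideHom j hj ≫ o.hom)) ⟨Over.homMk (wideHom j hj) rfl, fun hn ↦ nj ?_⟩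
    rw [← h.isIso_wideHom_iff hj]
    exact inferInstanceAs (IsIso ((Over.forget _).map (Over.homMk (wideHom j hj) rfl :
      Over.mk (wideHom j hj ≫ o.hom) ⟶ o)))

/-- Let `φ` kill `x`. If all proper restrictions of `x ≫ res F i` vanish by induction, then it is
fixed by `p`, and `p` factors through `toL`. Its image in `𝓛 F(w)` is killed by the monomorphism `𝓛
φ`, hence is zero. -/
theorem mono_app_of_isIso_map [IsIso ((functorL (regularBimodule h)).map φ)] (a : U) :
    Mono (φ.app (op ⟨a⟩)) := by
  refine Preadditive.mono_of_cancel_zero _ fun {X} x hx ↦ ?_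
  rw [← Category.comp_id x, ← res_id]
  refine induction_over h (motive := fun i _ ↦ x ≫ res F i = 0) fun {w} i hi ih ↦ ?_
  obtain ⟨p, h1, -, -, h4⟩ := exists_crossProj F w
  obtain ⟨q, hq⟩ := exists_toL_desc (a := ⟨w⟩) p h1
  have e1 : (x ≫ res F i) ≫ p = x ≫ res F i := h4 _ fun j hj nj ↦ by
    rw [Category.assoc, res_comp]
    exact ih j hj nj
  have e2 : (x ≫ res F i) ≫ toL F ⟨w⟩ = 0 := by
    rw [← cancel_mono (((functorL (regularBimodule h)).map φ).app (op ⟨w⟩)), zero_comp,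
      Category.assoc, toL_naturality, Category.assoc, ← Category.assoc (res F i)]
    refine (congrArg (x ≫ · ≫ _) (res_naturality φ i)).trans ?_
    rw [Category.assoc, reassoc_of% hx, zero_comp]
  rw [← e1, ← hq, ← Category.assoc, e2, zero_comp]

/-- Dually, once `extend F' i hi ≫ x` vanishes on proper extensions it descends to `𝓛 F'(w)`, where
it is zero because `𝓛 φ` is epic. The projection `p` is not needed on this side. -/
theorem epi_app_of_isIso_map [IsIso ((functorL (regularBimodule h)).map φ)] (a : U) :
    Epi (φ.app (op ⟨a⟩)) := by
  refine Preadditive.epi_of_cancel_zero _ fun {X} x hx ↦ ?_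
  have e0 : extend F' (𝟙 a) (I.id_mem a) = 𝟙 _ := by
    have := extend_res F' (𝟙 a) (I.id_mem a)
    rwa [res_id, Category.comp_id] at this
  rw [← Category.id_comp x, ← e0]
  refine induction_over h (motive := fun i hi ↦ extend F' i hi ≫ x = 0) fun {w} i hi ih ↦ ?_
  obtain ⟨y, hy⟩ := exists_toL_desc (F := F') (a := ⟨w⟩) (extend F' i hi ≫ x) fun j hj nj ↦ by
    rw [← Category.assoc, extend_comp]
    exact ih j hj nj
  rw [← hy]
  have : y = 0 := by
    rw [← cancel_epi (((functorL (regularBimodule h)).map φ).app (op ⟨w⟩)),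
      ← cancel_epi (toL F ⟨w⟩), ← Category.assoc, toL_naturality, Category.assoc, hy,
      comp_zero, comp_zero, ← Category.assoc]
    refine (congrArg (· ≫ x) (extend_naturality φ i hi)).symm.trans ?_
    rw [Category.assoc, hx, comp_zero]
  rw [this, comp_zero]

end

variable [Abelian C] [HasLimitsOfSize.{w, w} C] [HasColimitsOfSize.{w, w} C]

instance : (functorL (C := C) (regularBimodule h)).ReflectsIsomorphisms where
  reflects φ _ := by
    have (a : (ThreeFold h)ᵒᵖ) : IsIso (φ.app a) := by
      have := mono_app_of_isIso_map φ a.unop.obj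
      have := epi_app_of_isIso_map φ a.unop.obj
      -- Here `C` being abelian enters: monic and epic components are invertible.
      exact isIso_of_mono_of_epi (φ.app (op ⟨a.unop.obj⟩))
    exact NatIso.isIso_of_isIso_app φ

theorem isAdjointEquivalence_of_isEquivalence {D : Type u} {D' : Type u₁} [Category.{v} D]
    [Category.{v₁} D'] {L : D ⥤ D'} {R : D' ⥤ D} (adj : L ⊣ R) [R.IsEquivalence] :
    IsAdjointEquivalence adj :=
  have := adj.isEquivalence_left_of_isEquivalence_right
  ⟨inferInstance, inferInstance, inferInstance, inferInstance⟩

/-- In the triangle identity the counit is invertible, so `𝓛` sends the unit to isomorphisms, and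
`𝓛` reflects them. -/
instance : (functorR (C := C) (regularBimodule h)).IsEquivalence := by
  let adj := adjunctionLR (C := C) (regularBimodule h)
  have (F : (ThreeFold h)ᵒᵖ ⥤ C) : IsIso (adj.unit.app F) := by
    have := adj.left_triangle_components F
    have : IsIso ((functorL (regularBimodule h)).map (adj.unit.app F) ≫ adj.counit.app _) := by
      rw [this]
      exact inferInstanceAs (IsIso (𝟙 _))
    have := IsIso.of_isIso_comp_right ((functorL (regularBimodule h)).map (adj.unit.app F))
      (adj.counit.app _)
    exact isIso_of_reflects_iso _ (functorL (regularBimodule h))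
  exact adj.toEquivalence.isEquivalence_inverse

end

/-! ### Transport of `𝓡` along equivalences. -/

section

variable {A A' B B' : Type w} [SmallCategory A] [SmallCategory A'] [SmallCategory B]
  [SmallCategory B'] {C : Type u} [Category.{v} C] [HasZeroMorphisms C] [HasLimitsOfSize.{w, w} C]
  (P : A'ᵒᵖ ⥤ B' ⥤ Pointed.{w}) (e : A ≌ A') (Φ : B ⥤ B')

/-- The restriction of a bimodule along an equivalence and a functor. -/
abbrev restrictBimodule : Aᵒᵖ ⥤ B ⥤ Pointed.{w} :=
  e.functor.op ⋙ P ⋙ (Functor.whiskeringLeft B B' Pointed.{w}).obj Φ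

/-- The comparison of `𝓡` for a bimodule and for its restriction. -/
def restrictR (G : A'ᵒᵖ ⥤ C) :
    Φ.op ⋙ (functorR P).obj G ⟶ (functorR (restrictBimodule P e Φ)).obj (e.functor.op ⋙ G) :=
  functorR.lift (P := restrictBimodule P e Φ)
    (fun b a p ↦ functorR.π P G (op (Φ.obj b.unop)) (e.functor.obj a) p)
    (fun b a ↦ functorR.π_point P G (op (Φ.obj b.unop)) (e.functor.obj a))
    (fun b _ _ α p ↦ functorR.condition P G (op (Φ.obj b.unop)) (e.functor.map α) p)
    (fun _ _ β a p ↦ functorR.map_π P G (Φ.map β.unop).op (e.functor.obj a) p)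

/-- The projections of `𝓡` for the restriction of a bimodule. -/
def restrictπ (G : A'ᵒᵖ ⥤ C) (b : Bᵒᵖ) (a : A)
    (p : ((P.obj (op (e.functor.obj a))).obj (Φ.obj b.unop)).X) :
    ((functorR (restrictBimodule P e Φ)).obj (e.functor.op ⋙ G)).obj b ⟶
      G.obj (op (e.functor.obj a)) :=
  functorR.π (restrictBimodule P e Φ) (e.functor.op ⋙ G) b a p

theorem restrictπ_point (G : A'ᵒᵖ ⥤ C) (b : Bᵒᵖ) (a : A) :
    restrictπ P e Φ G b a ((P.obj (op (e.functor.obj a))).obj (Φ.obj b.unop)).point = 0 :=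
  functorR.π_point (restrictBimodule P e Φ) (e.functor.op ⋙ G) b a

theorem restrictπ_map (G : A'ᵒᵖ ⥤ C) (b : Bᵒᵖ) {a a' : A} (α : a ⟶ a')
    (p : ((P.obj (op (e.functor.obj a'))).obj (Φ.obj b.unop)).X) :
    restrictπ P e Φ G b a' p ≫ G.map (e.functor.map α).op =
      restrictπ P e Φ G b a (((P.map (e.functor.map α).op).app (Φ.obj b.unop)).toFun p) :=
  functorR.condition (restrictBimodule P e Φ) (e.functor.op ⋙ G) b α p

variable {P e Φ} in
theorem restrictπ_hom_ext {G : A'ᵒᵖ ⥤ C} {b : Bᵒᵖ} {X : C}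
    {x y : X ⟶ ((functorR (restrictBimodule P e Φ)).obj (e.functor.op ⋙ G)).obj b}
    (exy : ∀ a p, x ≫ restrictπ P e Φ G b a p = y ≫ restrictπ P e Φ G b a p) : x = y :=
  functorR.hom_ext exy

theorem restrictπ_app {G G' : A'ᵒᵖ ⥤ C} (φ : G ⟶ G') (b : Bᵒᵖ) (a : A)
    (p : ((P.obj (op (e.functor.obj a))).obj (Φ.obj b.unop)).X) :
    ((functorR (restrictBimodule P e Φ)).map (Functor.whiskerLeft e.functor.op φ)).app b ≫
      restrictπ P e Φ G' b a p = restrictπ P e Φ G b a p ≫ φ.app (op (e.functor.obj a)) :=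
  functorR.app_π (P := restrictBimodule P e Φ) (Functor.whiskerLeft e.functor.op φ) b a p

/-- The components of the comparison of `𝓡` for a bimodule and for its restriction. -/
def restrictRApp (G : A'ᵒᵖ ⥤ C) (b : Bᵒᵖ) : ((functorR P).obj G).obj (op (Φ.obj b.unop)) ⟶
    ((functorR (restrictBimodule P e Φ)).obj (e.functor.op ⋙ G)).obj b :=
  (restrictR P e Φ G).app b

theorem restrictRApp_π (G : A'ᵒᵖ ⥤ C) (b : Bᵒᵖ) (a : A)
    (p : ((P.obj (op (e.functor.obj a))).obj (Φ.obj b.unop)).X) :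
    restrictRApp P e Φ G b ≫ restrictπ P e Φ G b a p =
      functorR.π P G (op (Φ.obj b.unop)) (e.functor.obj a) p :=
  functorR.lift_π (P := restrictBimodule P e Φ) _ _ _ _ b a p

theorem bimodule_map_map {a a' a'' : A'} (f : a ⟶ a') (g : a' ⟶ a'') (b : B')
    (p : ((P.obj (op a'')).obj b).X) : ((P.map f.op).app b).toFun (((P.map g.op).app b).toFun p) =
      ((P.map (f ≫ g).op).app b).toFun p := by
  rw [op_comp, P.map_comp]
  rfl

theorem bimodule_map_id {a : A'} (b : B') {f : a ⟶ a} (hf : f = 𝟙 a)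
    (p : ((P.obj (op a)).obj b).X) : ((P.map f.op).app b).toFun p = p := by
  rw [hf, op_id, P.map_id]
  rfl

/-- An end over `A'` can be recovered from its components at the objects `e.functor.obj a`. For
general `a` in `A'` the index is pulled back along the counit isomorphism, and the resulting
component is carried to `G(a)` by its inverse. Naturality of the counit gives the compatibility. -/
theorem exists_restrictRInv (G : A'ᵒᵖ ⥤ C) (b : Bᵒᵖ) :
    ∃ inv : ((functorR (restrictBimodule P e Φ)).obj (e.functor.op ⋙ G)).obj b ⟶
      ((functorR P).obj G).obj (op (Φ.obj b.unop)),
      ∀ (a : A') (p : ((P.obj (op a)).obj (Φ.obj b.unop)).X),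
        inv ≫ functorR.π P G (op (Φ.obj b.unop)) a p = restrictπ P e Φ G b (e.inverse.obj a)
          (((P.map (e.counitIso.hom.app a).op).app (Φ.obj b.unop)).toFun p) ≫
            G.map (e.counitIso.inv.app a).op := by
  refine ⟨functorR.liftApp (fun a p ↦ restrictπ P e Φ G b (e.inverse.obj a)
          (((P.map (e.counitIso.hom.app a).op).app (Φ.obj b.unop)).toFun p) ≫
            G.map (e.counitIso.inv.app a).op) (fun a ↦ ?_) (fun a a' α p ↦ ?_),
    fun a p ↦ functorR.liftApp_π (P := P) (b := op (Φ.obj b.unop)) _ _ _ a p⟩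
  · have e1 := ((P.map (e.counitIso.hom.app a).op).app (Φ.obj b.unop)).map_point
    refine (congrArg (fun p ↦ restrictπ P e Φ G b (e.inverse.obj a) p ≫ _) e1).trans ?_
    exact (congrArg (· ≫ _) (restrictπ_point P e Φ G b (e.inverse.obj a))).trans zero_comp
  · have e1 : G.map (e.counitIso.inv.app a').op ≫ G.map α.op =
        G.map (e.functor.map (e.inverse.map α)).op ≫ G.map (e.counitIso.inv.app a).op := by
      rw [← G.map_comp, ← op_comp, ← G.map_comp, ← op_comp]
      exact congrArg (fun f ↦ G.map (Quiver.Hom.op f)) (e.counitIso.inv.naturality α)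
    have e2 : e.functor.map (e.inverse.map α) ≫ e.counitIso.hom.app a' =
      e.counitIso.hom.app a ≫ α := e.counitIso.hom.naturality α
    refine (Category.assoc _ _ _).trans ((congrArg (_ ≫ ·) e1).trans ?_)
    refine (Category.assoc _ _ _).symm.trans ?_
    refine congrArg (· ≫ _) ((restrictπ_map P e Φ G b (e.inverse.map α) _).trans ?_)
    refine congrArg _ ((bimodule_map_map P _ _ _ _).trans ?_)
    rw [e2]
    exact (bimodule_map_map P _ _ _ _).symm

/-- One composite reduces to the counit being invertible, the other to the triangle identity of `e`.
-/
instance isIso_restrictRApp (G : A'ᵒᵖ ⥤ C) (b : Bᵒᵖ) : IsIso (restrictRApp P e Φ G b) := by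
  obtain ⟨inv, hinv⟩ := exists_restrictRInv P e Φ G b
  refine ⟨inv, functorR.hom_ext fun a p ↦ ?_, restrictπ_hom_ext fun a p ↦ ?_⟩
  · rw [Category.assoc, Category.id_comp]
    refine (congrArg (_ ≫ ·) (hinv a p)).trans ?_
    rw [← Category.assoc, restrictRApp_π]
    refine (functorR.condition P G (op (Φ.obj b.unop)) (e.counitIso.inv.app a) _).trans ?_
    refine congrArg _ ((bimodule_map_map P _ _ _ _).trans ?_)
    exact bimodule_map_id P _ (e.counitIso.inv_hom_id_app a) p
  · rw [Category.assoc, restrictRApp_π, Category.id_comp, hinv]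
    have e1 : e.counitIso.inv.app (e.functor.obj a) = e.functor.map (e.unit.app a) :=
      e.counitInv_app_functor a
    rw [e1]
    refine (restrictπ_map P e Φ G b (e.unit.app a) _).trans ?_
    refine congrArg _ ((bimodule_map_map P _ _ _ _).trans ?_)
    exact bimodule_map_id P _ (e.functor_unit_comp a) p

/-- The functor `𝓡` of a restricted bimodule, up to the restriction functors. -/
def restrictRIso : functorR (C := C) P ⋙ (Functor.whiskeringLeft _ _ C).obj Φ.op ≅
    (Functor.whiskeringLeft _ _ C).obj e.functor.op ⋙ functorR (restrictBimodule P e Φ) :=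
  NatIso.ofComponents (fun G ↦ NatIso.ofComponents (fun b ↦ asIso (restrictRApp P e Φ G b))
      fun β ↦ (restrictR P e Φ G).naturality β) fun {G G'} φ ↦ by
    ext b : 2
    refine restrictπ_hom_ext fun a p ↦ ?_
    refine (Category.assoc _ _ _).trans ((congrArg (_ ≫ ·) (restrictRApp_π P e Φ G' b a p)).trans ?_)
    refine (functorR.app_π (P := P) φ (op (Φ.obj b.unop)) (e.functor.obj a) p).trans ?_
    refine Eq.trans ?_ (Category.assoc _ _ _).symm
    refine Eq.trans ?_ (congrArg (_ ≫ ·) (restrictπ_app P e Φ φ b a p)).symm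
    refine Eq.trans ?_ (Category.assoc _ _ _)
    exact (congrArg (· ≫ _) (restrictRApp_π P e Φ G b a p)).symm

/-- Cancellation in `restrictRIso`: precomposition with an equivalence is an equivalence, so the
remaining factor is one too. -/
theorem isEquivalence_functorR_restrict [Φ.IsEquivalence] [(functorR (C := C) P).IsEquivalence] :
    (functorR (C := C) (restrictBimodule P e Φ)).IsEquivalence := by
  have := Functor.isEquivalence_of_iso (restrictRIso (C := C) P e Φ)
  exact Functor.isEquivalence_of_comp_left ((Functor.whiskeringLeft _ _ C).obj e.functor.op) _

end

theorem ConjugatePair.isAdjointEquivalence {C : Type u} [Category.{v} C] [Abelian C]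
    [HasLimitsOfSize.{w, w} C] [HasColimitsOfSize.{w, w} C] {B A : Type w} [SmallCategory B]
    [SmallCategory A] (p : ConjugatePair B A) :
    IsAdjointEquivalence (adjunctionLR (C := C) p.bimodule) :=
  have : (functorR (C := C) p.bimodule).IsEquivalence :=
    isEquivalence_functorR_restrict (ThreeFold.regularBimodule p.admits) p.equivA p.equivB.functor
  isAdjointEquivalence_of_isEquivalence _

/-! ### The factorization of regular based maps into surjections and ordered maps. -/

namespace GammaCat

theorem Reg.hom_ext {X Y : Reg} {f g : X ⟶ Y} (e : ∀ x, f.hom.1 x = g.hom.1 x) : f = g :=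
  WideSubcategory.hom_ext _ (Subtype.ext (funext e))

theorem Reg.congr_hom {X Y : Reg} {f g : X ⟶ Y} (e : f = g) (x : Fin (X.obj.n + 1)) :
    f.hom.1 x = g.hom.1 x := by
  rw [e]

theorem Reg.map_zero {X Y : Reg} (f : X ⟶ Y) : f.hom.1 0 = 0 := f.hom.2

theorem Reg.map_eq_zero {X Y : Reg} (f : X ⟶ Y) {x : Fin (X.obj.n + 1)} (hx : f.hom.1 x = 0) :
    x = 0 := f.property x hx

/-- A morphism of `𝓤` from a regular based map. -/
def Reg.mk {X Y : Reg} (f : Fin (X.obj.n + 1) → Fin (Y.obj.n + 1)) (h0 : f 0 = 0)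
    (h1 : ∀ x, f x = 0 → x = 0) : X ⟶ Y :=
  wideHom (W := regular) (x := X.obj) (y := Y.obj) ⟨f, h0⟩ h1

/-- The elements of `S` are enumerated in increasing order. The enumeration is based because `0` is
the least element of `S`, and `m` counts the elements of `S` other than `0`. -/
theorem Reg.exists_ordered (X : Reg) (S : Set (Fin (X.obj.n + 1))) (h0 : 0 ∈ S) :
    ∃ (W : Reg) (i : W ⟶ X), ordered i ∧ Set.range i.hom.1 = S := by
  classical
  obtain ⟨m, hm⟩ : ∃ m, S.toFinset.card = m + 1 :=
    Nat.exists_eq_succ_of_ne_zero (Finset.card_ne_zero_of_mem (Set.mem_toFinset.2 h0))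
  have hr : Set.range (S.toFinset.orderEmbOfFin hm) = S := by
    rw [Finset.range_orderEmbOfFin, Set.coe_toFinset]
  have hz : S.toFinset.orderEmbOfFin hm 0 = 0 := by
    obtain ⟨k, hk⟩ := hr.symm ▸ h0
    exact le_antisymm (hk ▸ (S.toFinset.orderEmbOfFin hm).monotone (Fin.zero_le k)) (Fin.zero_le _)
  exact ⟨⟨⟨m⟩⟩, Reg.mk (X := ⟨⟨m⟩⟩) (S.toFinset.orderEmbOfFin hm) hz
    fun x hx ↦ (S.toFinset.orderEmbOfFin hm).injective (hx.trans hz.symm),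
    (S.toFinset.orderEmbOfFin hm).strictMono, hr⟩

theorem Reg.mono_of_injective {X Y : Reg} (f : X ⟶ Y) (hf : Function.Injective f.hom.1) :
    Mono f where
  right_cancellation _ _ e := Reg.hom_ext fun x ↦ hf (Reg.congr_hom e x)

theorem Reg.exists_comp_eq {T W X : Reg} (i : W ⟶ X) (hi : Function.Injective i.hom.1) (f : T ⟶ X)
    (hf : ∀ t, f.hom.1 t ∈ Set.range i.hom.1) : ∃ g : T ⟶ W, g ≫ i = f := by
  choose g hg using hf
  refine ⟨Reg.mk g (hi ?_) fun x hx ↦ f.property x ?_, Reg.hom_ext hg⟩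
  · rw [hg, Reg.map_zero, Reg.map_zero]
  · rw [← hg, hx, Reg.map_zero]

/-- Since `i'` and `i` are monic, lifts are unique and their compatibility with `f'` is automatic.
Only existence of the first factorization has to be tested, pointwise. -/
theorem Reg.isPullback {P X Y Z : Reg} {i' : P ⟶ X} {f' : P ⟶ Y} {f : X ⟶ Z} {i : Y ⟶ Z}
    (w : i' ≫ f = f' ≫ i) (hi' : Function.Injective i'.hom.1) (hi : Function.Injective i.hom.1)
    (hr : ∀ x y, f.hom.1 x = i.hom.1 y → x ∈ Set.range i'.hom.1) : IsPullback i' f' f i := by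
  have := Reg.mono_of_injective i' hi'
  have := Reg.mono_of_injective i hi
  refine IsPullback.mk' w (fun _ _ _ e _ ↦ by rwa [cancel_mono] at e) fun T a b e ↦ ?_
  obtain ⟨l, rfl⟩ := Reg.exists_comp_eq i' hi' a fun t ↦ hr _ _ (Reg.congr_hom e t)
  exact ⟨l, rfl, by rw [← cancel_mono i, Category.assoc, ← w, ← e, Category.assoc]⟩

theorem ordered_of_comp {X Y Z : Reg} {f : X ⟶ Y} {g : Y ⟶ Z} (hg : ordered g)
    (hfg : ordered (f ≫ g)) : ordered f := fun _ _ hxy ↦ hg.lt_iff_lt.1 (hfg hxy)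

theorem ordered_injective {X Y : Reg} {f : X ⟶ Y} (hf : ordered f) : Function.Injective f.hom.1 :=
  StrictMono.injective hf

/-- A strictly increasing map is determined by its range, and an injective self-map of a finite set
is onto. -/
theorem ordered_endo {X : Reg} {f : X ⟶ X} (hf : ordered f) : f = 𝟙 X := by
  refine Reg.hom_ext fun x ↦ ?_
  have : f.hom.1 = id := (StrictMono.range_inj hf strictMono_id).1 (by
    rw [Set.range_id, (Finite.surjective_of_injective (ordered_injective hf)).range_eq])
  rw [this]
  rfl

/-- The pullback is the increasing enumeration of the preimage of the image of `g`. Its other leg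
and all lifts are ordered, since strictly increasing maps reflect the strict order. -/
theorem hasPullbacks_ordered : HasPullbacks (WideSubcategory ordered) := by
  have (X Y Z : WideSubcategory ordered) (f : X ⟶ Z) (g : Y ⟶ Z) : HasPullback f g := by
    obtain ⟨W, i, hi, hr⟩ := Reg.exists_ordered X.obj {x | f.hom.hom.1 x ∈ Set.range g.hom.hom.1}
      ⟨0, (Reg.map_zero g.hom).trans (Reg.map_zero f.hom).symm⟩
    obtain ⟨j, hj⟩ := Reg.exists_comp_eq g.hom (ordered_injective g.property) (i ≫ f.hom)
      fun t ↦ hr.subset ⟨t, rfl⟩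
    have hjo : ordered j := ordered_of_comp g.property
      (hj ▸ ordered.comp_mem _ _ hi f.property)
    have sq : IsPullback i j f.hom g.hom := Reg.isPullback hj.symm (ordered_injective hi)
      (ordered_injective g.property) fun x y e ↦ hr.symm.subset ⟨y, e.symm⟩
    have := Reg.mono_of_injective i (ordered_injective hi)
    have sq' : IsPullback (wideHom i hi) (wideHom j hjo) f g := by
      refine IsPullback.mk' (WideSubcategory.hom_ext _ sq.w) (fun T a b e _ ↦ ?_) fun T a b e ↦ ?_
      · refine WideSubcategory.hom_ext _ ((cancel_mono i).1 ?_)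
        exact congrArg InducedWideCategory.Hom.hom e
      · obtain ⟨l, h1, h2⟩ := sq.exists_lift a.hom b.hom (congrArg InducedWideCategory.Hom.hom e)
        exact ⟨wideHom l (ordered_of_comp hi (h1 ▸ a.property)), WideSubcategory.hom_ext _ h1,
          WideSubcategory.hom_ext _ h2⟩
    exact sq'.hasPullback
  exact hasPullbacks_of_hasLimit_cospan _

instance (X Y : WideSubcategory ordered) : Finite (X ⟶ Y) :=
  Finite.of_injective (fun f : X ⟶ Y ↦ f.hom.hom.1) fun _ _ e ↦
    WideSubcategory.hom_ext _ (Reg.hom_ext (congrFun e))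

theorem isIndexing_ordered : IsIndexing (WideSubcategory ordered) where
  ei {X} f := by
    have : f = 𝟙 X := WideSubcategory.hom_ext _ (ordered_endo f.property)
    rw [this]
    infer_instance
  hasPullbacks := hasPullbacks_ordered
  finite_skeleton a := by
    have : Finite (Over a) := by
      -- Ordered maps are injective, so the source of an object of the slice has at most as many
      -- elements as its target.
      refine Finite.of_surjective (α := Σ m : Fin (a.obj.obj.n + 1),
        ((⟨⟨⟨m.1⟩⟩⟩ : WideSubcategory ordered) ⟶ a)) (fun f ↦ Over.mk f.2) fun o ↦ ?_
      have := Fintype.card_le_of_injective _ (ordered_injective o.hom.property)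
      rw [Fintype.card_fin, Fintype.card_fin] at this
      exact ⟨⟨⟨o.left.obj.obj.n, this⟩, o.hom⟩, rfl⟩
    exact Finite.of_surjective (toSkeleton (C := Over a)) Quotient.mk_surjective

/-- Maps in both directions between two subobjects of `Z` are mutually inverse because `i` and `j`
are monic. -/
theorem isoIn_ordered {X Y Z : Reg} {t : X ⟶ Y} {s : Y ⟶ X} {i : X ⟶ Z} {j : Y ⟶ Z}
    (hi : ordered i) (hj : ordered j) (ht : t ≫ j = i) (hs : s ≫ i = j) : IsoIn ordered t := by
  have := Reg.mono_of_injective i (ordered_injective hi)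
  have := Reg.mono_of_injective j (ordered_injective hj)
  refine ⟨ordered_of_comp hj (ht.symm ▸ hi), s, ordered_of_comp hi (hs.symm ▸ hj), ?_, ?_⟩
  · rw [← cancel_mono i, Category.assoc, hs, ht, Category.id_comp]
  · rw [← cancel_mono j, Category.assoc, ht, hs, Category.id_comp]

/-- The factorization `𝓤 = 𝓞 ∘ ℰ` admits conjugation. -/
theorem admitsConjugation : AdmitsConjugation ordered surj where
  indexing := isIndexing_ordered
  factors {X Y} f := by
    obtain ⟨W, i, hi, hr⟩ := Reg.exists_ordered Y (Set.range f.hom.1) ⟨0, Reg.map_zero f⟩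
    obtain ⟨α, rfl⟩ := Reg.exists_comp_eq i (ordered_injective hi) f
      fun t ↦ hr.symm.subset ⟨t, rfl⟩
    refine ⟨W, α, i, fun w ↦ ?_, hi, rfl⟩
    obtain ⟨x, hx⟩ := hr.subset ⟨w, rfl⟩
    exact ⟨x, ordered_injective hi hx⟩
  iso_le f := by
    rintro ⟨-, g, -, h1, h2⟩
    exact ⟨fun y ↦ ⟨_, Reg.congr_hom h2 y⟩, g, fun y ↦ ⟨_, Reg.congr_hom h1 y⟩, h1, h2⟩
  lifts α i β j hα hβ hi hj e := by
    -- As `α` and `β` are surjective, `i` and `j` both have the image of the common composite, so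
    -- each factors through the other.
    obtain ⟨t, ht⟩ := Reg.exists_comp_eq i (ordered_injective hi) j fun x ↦ by
      obtain ⟨y, rfl⟩ := hβ x
      exact ⟨_, Reg.congr_hom e y⟩
    obtain ⟨s, hs⟩ := Reg.exists_comp_eq j (ordered_injective hj) i fun x ↦ by
      obtain ⟨y, rfl⟩ := hα x
      exact ⟨_, (Reg.congr_hom e y).symm⟩
    have := Reg.mono_of_injective i (ordered_injective hi)
    exact ⟨t, by rw [← cancel_mono i, Category.assoc, ht, e], ht, isoIn_ordered hj hi ht hs⟩
  pullbacks {a b c} α i hα hi := by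
    obtain ⟨W, i', hi', hr⟩ := Reg.exists_ordered a {x | α.hom.1 x ∈ Set.range i.hom.1}
      ⟨0, (Reg.map_zero i).trans (Reg.map_zero α).symm⟩
    obtain ⟨α', hα'⟩ := Reg.exists_comp_eq i (ordered_injective hi) (i' ≫ α)
      fun t ↦ hr.subset ⟨t, rfl⟩
    refine ⟨W, i', α', hi', fun y ↦ ?_, Reg.isPullback hα'.symm (ordered_injective hi')
      (ordered_injective hi) fun x y e ↦ hr.symm.subset ⟨y, e.symm⟩⟩
    -- Any preimage of `i(y)` under the surjection `α` lies in the subset enumerated by `i'`, so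
    -- `α'` is again surjective.
    obtain ⟨x, hx⟩ := hα (i.hom.1 y)
    obtain ⟨z, rfl⟩ := hr.symm.subset (show x ∈ _ from ⟨y, hx.symm⟩)
    exact ⟨z, ordered_injective hi ((Reg.congr_hom hα' z).trans hx)⟩
  pullbacks_unique {a b c} α i hα hi p i' α' q i'' α'' hi' hα' sq hi'' hα'' sq' t ht _ := by
    obtain ⟨s, hs, -⟩ := sq.exists_lift i'' α'' sq'.w
    exact isoIn_ordered hi' hi'' ht hs

/-! ### The equivalence of `Γ` with `𝓞 ∘ ℰ ∘ 𝓞^op` -/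

/-- The based map represented by a three-fold diagram `(i, α, j)`: it is `j ∘ α ∘ i⁻¹` on the image
of `i` and zero elsewhere. -/
def spanFun {X Y : Reg} (x : Rep ordered surj X Y) : Fin (X.obj.n + 1) → Fin (Y.obj.n + 1) :=
  Function.extend x.i.hom.1 x.u.hom.1 fun _ ↦ 0

theorem spanFun_i {X Y : Reg} (x : Rep ordered surj X Y) (k : Fin (x.dom.obj.n + 1)) :
    spanFun x (x.i.hom.1 k) = x.u.hom.1 k := (ordered_injective x.hi).extend_apply _ _ _

theorem mem_range_of_spanFun {X Y : Reg} {x : Rep ordered surj X Y} {z : Fin (X.obj.n + 1)}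
    (hz : spanFun x z ≠ 0) : z ∈ Set.range x.i.hom.1 := by
  by_contra hn
  exact hz (Function.extend_apply' _ _ _ hn)

theorem spanFun_zero {X Y : Reg} (x : Rep ordered surj X Y) : spanFun x 0 = 0 := by
  rw [← Reg.map_zero x.i, spanFun_i, Reg.map_zero]

/-- The working criterion for recognizing the based map of a diagram: the values on the image of
`x.i`, and support contained in that image. -/
theorem spanFun_eq {X Y : Reg} {x : Rep ordered surj X Y} {g : Fin (X.obj.n + 1) → Fin (Y.obj.n + 1)}
    (h1 : ∀ k, g (x.i.hom.1 k) = x.u.hom.1 k) (h2 : ∀ z, g z ≠ 0 → z ∈ Set.range x.i.hom.1) :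
    spanFun x = g := by
  funext z
  by_cases hz : z ∈ Set.range x.i.hom.1
  · obtain ⟨k, rfl⟩ := hz
    rw [spanFun_i, h1]
  · rw [not_imp_comm.1 (h2 z) hz]
    exact Function.extend_apply' _ _ _ hz

theorem spanFun_eq_of_equiv {X Y : Reg} {x y : Rep ordered surj X Y} (e : x.Equiv y) :
    spanFun x = spanFun y := by
  obtain ⟨t, s, h1, h2, e1, e2⟩ := e.span
  refine spanFun_eq (fun k ↦ ?_) fun z hz ↦ ?_
  · rw [← e1, ← e2]
    exact spanFun_i y _
  · obtain ⟨k, rfl⟩ := mem_range_of_spanFun hz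
    rw [← e1]
    exact ⟨s.hom.1 k, congrArg y.i.hom.1 (Reg.congr_hom h2 k)⟩

/-- The map from the based set with one further point to `X` given by an element of `X`. -/
def Reg.point {X : Reg} (x : Fin (X.obj.n + 1)) (hx : x ≠ 0) : (⟨⟨1⟩⟩ : Reg) ⟶ X :=
  Reg.mk (X := ⟨⟨1⟩⟩) (fun k ↦ if k = 0 then 0 else x) (if_pos rfl) fun k hk ↦ by
    by_contra hn
    exact hx ((if_neg hn).symm.trans hk)

theorem Reg.point_one {X : Reg} (x : Fin (X.obj.n + 1)) (hx : x ≠ 0) :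
    (Reg.point x hx).hom.1 (1 : Fin 2) = x :=
  if_neg (t := (0 : Fin (X.obj.n + 1))) (show (1 : Fin 2) ≠ 0 by decide)

/-- The elements other than the base point are represented by the based set `1_+`, so the universal
property can be tested on it. The base point is always hit. Regularity of `f` ensures that `y` is
not the base point when `x` is not. -/
theorem Reg.exists_of_isPullback {P X Y Z : Reg} {p : P ⟶ X} {q : P ⟶ Y} {f : X ⟶ Z} {g : Y ⟶ Z}
    (sq : IsPullback p q f g) {x : Fin (X.obj.n + 1)} {y : Fin (Y.obj.n + 1)}
    (e : f.hom.1 x = g.hom.1 y) : ∃ k, p.hom.1 k = x := by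
  by_cases hx : x = 0
  · exact ⟨0, hx ▸ Reg.map_zero p⟩
  have hy : y ≠ 0 := by
    rintro rfl
    rw [Reg.map_zero] at e
    exact hx (Reg.map_eq_zero f e)
  obtain ⟨l, hl, -⟩ := sq.exists_lift (Reg.point x hx) (Reg.point y hy) (Reg.hom_ext fun k ↦ by
    by_cases hk : k = 0
    · subst hk
      rw [Reg.map_zero, Reg.map_zero]
    · exact (congrArg f.hom.1 (if_neg hk)).trans (e.trans (congrArg g.hom.1 (if_neg hk)).symm))
  exact ⟨l.hom.1 (1 : Fin 2), (Reg.congr_hom hl (1 : Fin 2)).trans (Reg.point_one x hx)⟩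

/-- The functor `𝓞 ∘ ℰ ∘ 𝓞^op → Γ`. -/
def ofThreeFold : ThreeFold admitsConjugation ⥤ GammaCat where
  obj X := X.obj.obj
  map {X Y} f := Quotient.lift (s := Rep.setoid admitsConjugation X.obj Y.obj)
    (fun x ↦ (⟨spanFun x, spanFun_zero x⟩ : X.obj.obj ⟶ Y.obj.obj))
    (fun _ _ e ↦ Subtype.ext (spanFun_eq_of_equiv e)) f
  map_id X := Subtype.ext (spanFun_eq (x := Rep.id ordered surj X.obj) (g := id) (fun _ ↦ rfl)
    fun z _ ↦ ⟨z, rfl⟩)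
  map_comp {X Y Z} f g := by
    obtain ⟨x, rfl⟩ := ThreeFold.homMk_surj f
    obtain ⟨y, rfl⟩ := ThreeFold.homMk_surj g
    obtain ⟨z, p, q, e, sq, e1, e2⟩ := ThreeFold.homMk_comp_span x y
    rw [e]
    refine Subtype.ext (spanFun_eq (x := z) (g := spanFun y ∘ spanFun x) (fun k ↦ ?_) fun w hw ↦ ?_)
    · rw [← e1, ← e2]
      refine (congrArg (spanFun y) ((spanFun_i x (p.hom.1 k)).trans (Reg.congr_hom sq.w k))).trans ?_
      exact spanFun_i y (q.hom.1 k)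
    -- A nonzero value at `w` forces `w` into the image of `x.i` and its value into the image of
    -- `y.i`. These two points have a common preimage in the pullback.
    · have hx : spanFun x w ≠ 0 := fun h0 ↦ hw ((congrArg (spanFun y) h0).trans (spanFun_zero y))
      obtain ⟨l, hl⟩ := mem_range_of_spanFun hw
      obtain ⟨m, rfl⟩ := mem_range_of_spanFun hx
      rw [spanFun_i] at hl
      obtain ⟨k, rfl⟩ := Reg.exists_of_isPullback sq hl.symm
      exact ⟨k, (Reg.congr_hom e1 k).symm⟩

/-- Since `x.u` is regular, `spanFun x` is nonzero at every point of the image of `x.i` except the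
base point. Thus the image of the first leg is the support together with `0`, and is determined by
the based map. -/
theorem exists_comp_of_spanFun_eq {X Y : Reg} {x y : Rep ordered surj X Y}
    (e : spanFun x = spanFun y) : ∃ t : x.dom ⟶ y.dom, t ≫ y.i = x.i := by
  refine Reg.exists_comp_eq y.i (ordered_injective y.hi) x.i fun k ↦ ?_
  by_cases hk : k = 0
  · exact ⟨0, by rw [hk, Reg.map_zero, Reg.map_zero]⟩
  · refine mem_range_of_spanFun fun h0 ↦ hk (Reg.map_eq_zero x.u ?_)
    rw [← spanFun_i, e, h0]

/-- Equal based maps have isomorphic first legs, and their values on the support then determine the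
remaining composite. -/
instance : ofThreeFold.Faithful where
  map_injective {X Y f g} e := by
    obtain ⟨x, rfl⟩ := ThreeFold.homMk_surj f
    obtain ⟨y, rfl⟩ := ThreeFold.homMk_surj g
    have e' : spanFun x = spanFun y := congrArg Subtype.val e
    obtain ⟨t, ht⟩ := exists_comp_of_spanFun_eq e'
    obtain ⟨s, hs⟩ := exists_comp_of_spanFun_eq e'.symm
    obtain ⟨-, s', -, h1, h2⟩ := isoIn_ordered x.hi y.hi ht hs
    refine ThreeFold.homMk_eq_iff.2 (admitsConjugation.rep_equiv_of_span t s' h1 h2 ht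
      (Reg.hom_ext fun k ↦ ?_))
    rw [← spanFun_i, e', ← ht]
    exact (spanFun_i y _).symm

instance : ofThreeFold.Full where
  map_surjective {X Y} g := by
    -- The first leg must enumerate the support of `g` together with the base point. On that subset
    -- `g` is regular and can be factored in `𝓤`.
    obtain ⟨W, i, hi, hr⟩ := Reg.exists_ordered X.obj {z | z = 0 ∨ g.1 z ≠ 0} (Or.inl rfl)
    let f : W ⟶ Y.obj := Reg.mk (g.1 ∘ i.hom.1) ((congrArg g.1 (Reg.map_zero i)).trans g.2)
      fun k hk ↦ Reg.map_eq_zero i ((hr.subset ⟨k, rfl⟩).resolve_right (not_not_intro hk))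
    obtain ⟨V, α, j, hα, hj, e⟩ := admitsConjugation.factors f
    refine ⟨ThreeFold.homMk _ ⟨W, V, i, α, j, hi, hα, hj⟩, Subtype.ext (spanFun_eq (fun k ↦ ?_)
      fun z hz ↦ hr.symm.subset (Or.inr hz))⟩
    exact (Reg.congr_hom e k).symm

instance : ofThreeFold.EssSurj where
  mem_essImage Y := ⟨⟨⟨Y⟩⟩, ⟨Iso.refl _⟩⟩

instance : ofThreeFold.IsEquivalence where

/-- On the subcategory `𝓤`, the functor to `Γ` is the inclusion. -/
def ofUCompOfThreeFold :
    ThreeFold.ofU admitsConjugation ⋙ ofThreeFold ≅ wideSubcategoryInclusion regular :=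
  NatIso.ofComponents (fun X ↦ Iso.refl X.obj) fun {X Y} f ↦ by
    obtain ⟨V, α, j, hα, hj, e⟩ := admitsConjugation.factors f
    refine (Category.comp_id _).trans (Eq.trans ?_ (Category.id_comp _).symm)
    refine (congrArg (ofThreeFold.map (X := ⟨X⟩) (Y := ⟨Y⟩))
      (ThreeFold.ofHom_eq admitsConjugation α j hα hj f e)).trans ?_
    exact Subtype.ext (spanFun_eq (x := Rep.reg α j hα hj) (g := f.hom.1)
      (fun k ↦ (Reg.congr_hom e k).symm) fun z _ ↦ ⟨z, rfl⟩)

/-- The equivalence of `Γ` with `𝓞 ∘ ℰ ∘ 𝓞^op`. -/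
def equivThreeFold : GammaCat ≌ ThreeFold admitsConjugation := ofThreeFold.asEquivalence.symm

/-- The equivalence of `Γ` with `𝓞 ∘ ℰ ∘ 𝓞^op` is compatible with the inclusions of `𝓤`. -/
def inclusionCompEquivThreeFold :
    wideSubcategoryInclusion regular ⋙ equivThreeFold.functor ≅ ThreeFold.ofU admitsConjugation :=
  Functor.isoWhiskerRight ofUCompOfThreeFold.symm ofThreeFold.inv ≪≫
    Functor.associator _ _ _ ≪≫
    Functor.isoWhiskerLeft _ ofThreeFold.asEquivalence.unitIso.symm ≪≫ Functor.rightUnitor _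

end GammaCat

/-! ### The category `ℰ` as the category of regular surjections. -/

namespace EpiCat

instance : addPoint.Faithful where
  map_injective e := Subtype.ext (funext fun x ↦ Fin.succ_injective _
    (congrFun (congrArg (fun k ↦ k.hom.hom.1) e) x.succ))

/-- A regular based map sends nonzero elements to nonzero elements, so the base points can be
removed. Preimages of nonzero elements are nonzero, which preserves surjectivity. -/
instance : addPoint.Full where
  map_surjective {X Y} g := by
    have hg (x : Fin X.n) : ∃ y : Fin Y.n, y.succ = g.hom.hom.1 x.succ :=
      Fin.exists_succ_eq.2 fun h0 ↦ Fin.succ_ne_zero x (GammaCat.Reg.map_eq_zero g.hom h0)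
    choose f hf using hg
    refine ⟨⟨f, fun y ↦ ?_⟩, WideSubcategory.hom_ext _ (GammaCat.Reg.hom_ext fun x ↦ ?_)⟩
    · obtain ⟨x, hx⟩ := g.property y.succ
      obtain ⟨x, rfl⟩ := Fin.exists_succ_eq.2 (show x ≠ 0 by
        rintro rfl
        exact Fin.succ_ne_zero y (hx.symm.trans (GammaCat.Reg.map_zero g.hom)))
      exact ⟨x, Fin.succ_injective _ ((hf x).trans hx)⟩
    · refine Fin.cases ?_ (fun x ↦ hf x) x
      exact (GammaCat.Reg.map_zero g.hom).symm

instance : addPoint.EssSurj where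
  mem_essImage Y := ⟨⟨Y.obj.obj.n⟩, ⟨Iso.refl _⟩⟩

instance : addPoint.IsEquivalence where

end EpiCat

end Conj
end

open Conj
theorem mainTheorem2 {C : Type u} [Category.{v} C] [Abelian C] [HasLimits C] [HasColimits C] :
    (∀ (B A : Type v) [SmallCategory B] [SmallCategory A] (p : ConjugatePair B A),
      IsAdjointEquivalence
        (adjunctionLR p.bimodule : functorL p.bimodule ⊣
          (functorR p.bimodule : (Aᵒᵖ ⥤ C) ⥤ (Bᵒᵖ ⥤ C)))) ∧
    ∃ (h : AdmitsConjugation GammaCat.ordered GammaCat.surj) (eB : GammaCat ≌ ThreeFold h)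
      (eA : EpiCat ≌ WideSubcategory GammaCat.surj),
      Nonempty (wideSubcategoryInclusion GammaCat.regular ⋙ eB.functor ≅ ThreeFold.ofU h) ∧
      Nonempty (eA.functor ≅ EpiCat.addPoint) ∧
      let p : ConjugatePair GammaCat EpiCat := ⟨GammaCat.Reg, GammaCat.ordered, GammaCat.surj, h, eB, eA⟩
      IsAdjointEquivalence
        (adjunctionLR p.bimodule : functorL p.bimodule ⊣
          (functorR p.bimodule : (EpiCatᵒᵖ ⥤ C) ⥤ (GammaCatᵒᵖ ⥤ C))) :=
  ⟨fun _ _ _ _ p ↦ p.isAdjointEquivalence, GammaCat.admitsConjugation, GammaCat.equivThreeFold,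
    EpiCat.addPoint.asEquivalence, ⟨GammaCat.inclusionCompEquivThreeFold⟩, ⟨Iso.refl _⟩,
    ConjugatePair.isAdjointEquivalence _⟩
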